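/- **Theorem (Bell Gaussianity test).** Let $\gamma_{2j-1}=(\prod_{k<j}Z_k)X_j$ and $\gamma_{2j}=(\prod_{k<j}Z_k)Y_j$, $1\le j\le n$, be the Jordan–Wigner Majorana operators on $n$ qubits. Let $\mathcal G_n$ be the set of pure fermionic Gaussian states, i.e. the pure states $|\phi\rangle$ for which $|\phi\rangle\langle\phi|$ is a limit of states of the form $e^{-\frac i2\sum_{a<b}K_{ab}\gamma_a\gamma_b}/\operatorname{tr}\big(e^{-\frac i2\sum_{a<b}K_{ab}\gamma_a\gamma_b}\big)$ with $K\in\mathbb R^{2n\times 2n}$ antisymmetric. For a pure state $\psi$ put $\epsilon_G(\psi)=\min_{\phi\in\mathcal G_n}\tfrac12\big\||\psi\rangle\langle\psi|-|\phi\rangle\langle\phi|\big\|_1$. A two-copy Bell measurement on $|\psi\rangle\otimes|\psi\rangle$ applies, for each $j$, a CNOT from qubit $j$ of copy 1 to qubit $j$ of copy 2 and then a Hadamard gate on qubit $j$ of copy 1, and measures all qubits in the computational basis, giving bits $u_j$ (copy 1) and $v_j$ (copy 2). Set $g_{2j-1}=(-1)^{u_j+\sum_{k<j}v_k}$, $g_{2j}=-(-1)^{u_j+v_j+\sum_{k<j}v_k}$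 and $X=\frac12\big(\sum_{a=1}^{2n}g_a\big)^2$. The Bell test with $N$ shots performs $N$ independent two-copy Bell measurements, rejects if at least one of them has $X\ne0$, and accepts otherwise. There is a universal constant $C>0$ such that for all $n$, all $\epsilon>0$, all $\delta\in(0,1)$, every integer $N\ge C\,\frac{n^2}{\epsilon^2}\log\frac1\delta$ and every pure $n$-qubit state $\psi$, the Bell test with $N$ shots satisfies the following: (i) if $\psi\in\mathcal G_n$, it accepts with probability $1$; (ii) if $\epsilon_G(\psi)\ge\epsilon$, it rejects with probability at least $1-\delta$. In particular, $O\big(\frac{n^2}{\epsilon^2}\log\frac1\delta\big)$ two-copy Bell measurements suffice. -/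

import Mathlib

open scoped Kronecker

noncomputable section

namespace GaussTest

/-- Bit strings of length `n`: the labels of the computational (Fock) basis of `n` qubits. -/
abbrev Bits (n : ℕ) : Type := Fin n → Fin 2

/-- Operators on `n` qubits, as matrices in the computational basis. -/
abbrev Op (n : ℕ) : Type := Matrix (Bits n) (Bits n) ℂ

/-- Pure states of `n` qubits: unit vectors of the `2 ^ n`-dimensional Hilbert space. -/
abbrev PureState (n : ℕ) : Type := {ψ : EuclideanSpace ℂ (Bits n) // ‖ψ‖ = 1}

/-- The density operator `|ψ⟩⟨ψ|`. -/
def PureState.density {n : ℕ} (ψ : PureState n) : Op n :=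
  Matrix.of fun x y => ψ.1 x * star (ψ.1 y)

/-- The Pauli matrix `X`. -/
def pauliX : Matrix (Fin 2) (Fin 2) ℂ := !![0, 1; 1, 0]

/-- The Pauli matrix `Y`. -/
def pauliY : Matrix (Fin 2) (Fin 2) ℂ := !![0, -Complex.I; Complex.I, 0]

/-- The Pauli matrix `Z`. -/
def pauliZ : Matrix (Fin 2) (Fin 2) ℂ := !![1, 0; 0, -1]

/-- The Hadamard matrix. -/
def hadamard : Matrix (Fin 2) (Fin 2) ℂ :=
  ((Real.sqrt 2 : ℂ)⁻¹) • !![1, 1; 1, -1]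

/-- The tensor product `A 0 ⊗ A 1 ⊗ ⋯ ⊗ A (n - 1)` of single-qubit operators. -/
def tensorOp {n : ℕ} (A : Fin n → Matrix (Fin 2) (Fin 2) ℂ) : Op n :=
  Matrix.of fun x y => ∏ k, A k (x k) (y k)

/-- The `2n` Majorana operators in the Jordan–Wigner representation. With modes numbered from `0`,
`majorana (j, 0) = (∏_{k < j} Z_k) X_j` and `majorana (j, 1) = (∏_{k < j} Z_k) Y_j`. -/
def majorana {n : ℕ} (a : Fin n × Fin 2) : Op n :=
  tensorOp fun k =>
    if k < a.1 then pauliZ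
    else if k = a.1 then (if a.2 = 0 then pauliX else pauliY)
    else 1

/-- The exponent `-(i/2) ∑_{a < b} K_{ab} γ_a γ_b`, for antisymmetric `K`. The sum here runs over
all ordered pairs `(a, b)`, so that each unordered pair is counted twice, whence the factor `1/4`. -/
def quadraticExponent {n : ℕ} (K : Matrix (Fin n × Fin 2) (Fin n × Fin 2) ℝ) : Op n :=
  (-(Complex.I / 4)) • ∑ a, ∑ b, (K a b : ℂ) • (majorana a * majorana b)

/-- The fermionic Gaussian (Gibbs) state `exp(-(i/2) ∑_{a < b} K_{ab} γ_a γ_b) / tr(⋯)`. -/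
def gibbsState {n : ℕ} (K : Matrix (Fin n × Fin 2) (Fin n × Fin 2) ℝ) : Op n :=
  (Matrix.trace (NormedSpace.exp (quadraticExponent K)))⁻¹ •
    NormedSpace.exp (quadraticExponent K)

/-- Fermionic Gaussian density operators: the states `gibbsState K` with `K` real antisymmetric,
together with their limits. The limits are needed because every `gibbsState K` has full rank, so
that (for `n ≥ 1`) the pure Gaussian states only occur as limits. -/
def gaussianStates (n : ℕ) : Set (Op n) :=
  closure {ρ | ∃ K : Matrix (Fin n × Fin 2) (Fin n × Fin 2) ℝ,
    K.transpose = -K ∧ ρ = gibbsState K}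

/-- The set of pure fermionic Gaussian states (of either parity). -/
def pureGaussianStates (n : ℕ) : Set (PureState n) :=
  {φ | φ.density ∈ gaussianStates n}

/-- The trace norm `‖A‖₁ = tr √(A† A)`: the sum of the singular values of `A`. -/
def traceNorm {n : ℕ} (A : Op n) : ℝ :=
  ∑ i, Real.sqrt ((Matrix.isHermitian_conjTranspose_mul_self A).eigenvalues i)

/-- The trace distance `‖ρ - σ‖₁ / 2`. -/
def traceDistance {n : ℕ} (ρ σ : Op n) : ℝ := traceNorm (ρ - σ) / 2

/-- The trace distance of a pure state to the set of pure fermionic Gaussian states. -/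
def gaussianDistance {n : ℕ} (ψ : PureState n) : ℝ :=
  sInf {d | ∃ φ ∈ pureGaussianStates n, d = traceDistance ψ.density φ.density}

/-- The two-copy state vector `|ψ⟩ ⊗ |ψ⟩`. -/
def twoCopy {n : ℕ} (ψ : PureState n) : Bits n × Bits n → ℂ :=
  fun p => ψ.1 p.1 * ψ.1 p.2

/-- For every `j`, a CNOT controlled by qubit `j` of copy 1 and acting on qubit `j` of copy 2:
`|x⟩|y⟩ ↦ |x⟩|x ⊕ y⟩`. (Addition of bit strings in `Fin n → Fin 2` is bitwise modulo 2.) -/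
def cnotLayer (n : ℕ) : Matrix (Bits n × Bits n) (Bits n × Bits n) ℂ :=
  Matrix.of fun p q => if p = (q.1, q.1 + q.2) then 1 else 0

/-- The Bell transformation: the CNOTs from copy 1 to copy 2, followed by a Hadamard gate on every
qubit of copy 1. -/
def bellCircuit (n : ℕ) : Matrix (Bits n × Bits n) (Bits n × Bits n) ℂ :=
  (tensorOp (fun _ : Fin n => hadamard) ⊗ₖ (1 : Op n)) * cnotLayer n

/-- The probability (Born rule) of reading the bit strings `(u, v)`, with `u` on copy 1 and `v` on
copy 2, when `|ψ⟩ ⊗ |ψ⟩` is measured in the computational basis after the Bell transformation. -/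
def bellProb {n : ℕ} (ψ : PureState n) (o : Bits n × Bits n) : ℝ :=
  ‖(bellCircuit n).mulVec (twoCopy ψ) o‖ ^ 2

theorem tensorOp_mul {n : ℕ} (A B : Fin n → Matrix (Fin 2) (Fin 2) ℂ) :
    tensorOp A * tensorOp B = tensorOp fun k => A k * B k := by
  ext x y
  simp only [tensorOp, Matrix.mul_apply, Matrix.of_apply]
  rw [Fintype.prod_sum]
  simp [Finset.prod_mul_distrib]

theorem tensorOp_one {n : ℕ} : tensorOp (fun _ : Fin n => 1) = 1 := by
  ext x y
  simp only [tensorOp, Matrix.of_apply, Matrix.one_apply]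
  rw [Finset.prod_ite_zero]
  simp [funext_iff]

theorem tensorOp_conjTranspose {n : ℕ} (A : Fin n → Matrix (Fin 2) (Fin 2) ℂ) :
    (tensorOp A).conjTranspose = tensorOp fun k => (A k).conjTranspose := by
  ext x y
  simp [tensorOp, Matrix.conjTranspose_apply]

theorem hadamard_unitary : hadamard.conjTranspose * hadamard = 1 := by
  have h : ((Real.sqrt 2 : ℂ)⁻¹) * ((Real.sqrt 2 : ℂ)⁻¹) = 1 / 2 := by
    rw [← mul_inv, ← Complex.ofReal_mul, Real.mul_self_sqrt (by norm_num)]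
    norm_num
  ext i j
  fin_cases i <;> fin_cases j <;>
    simp [hadamard, Matrix.mul_apply, Matrix.conjTranspose_apply, Fin.sum_univ_two, h] <;> norm_num

theorem cnotLayer_unitary (n : ℕ) : (cnotLayer n).conjTranspose * cnotLayer n = 1 := by
  ext p q
  simp only [cnotLayer, Matrix.mul_apply, Matrix.conjTranspose_apply, Matrix.of_apply,
    Matrix.one_apply]
  rw [Finset.sum_eq_single (q.1, q.1 + q.2)]
  · by_cases h : p = q
    · simp [h]
    · have h' : ¬ (q.1, q.1 + q.2) = (p.1, p.1 + p.2) := by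
        intro e
        rw [Prod.mk.injEq] at e
        obtain ⟨e1, e2⟩ := e
        rw [e1] at e2
        exact h (Prod.ext e1.symm (add_left_cancel e2).symm)
      rw [if_neg h', if_neg h]
      simp
  · intro b _ hb
    simp [hb]
  · simp

theorem bellCircuit_unitary (n : ℕ) : (bellCircuit n).conjTranspose * bellCircuit n = 1 := by
  have h : (tensorOp (fun _ : Fin n => hadamard) ⊗ₖ (1 : Op n)).conjTranspose *
      (tensorOp (fun _ : Fin n => hadamard) ⊗ₖ (1 : Op n)) = 1 := by
    rw [Matrix.conjTranspose_kronecker, ← Matrix.mul_kronecker_mul, tensorOp_conjTranspose,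
      tensorOp_mul]
    simp [hadamard_unitary, tensorOp_one]
  rw [bellCircuit, Matrix.conjTranspose_mul, Matrix.mul_assoc,
    ← Matrix.mul_assoc (Matrix.conjTranspose _) (_ ⊗ₖ _), h, Matrix.one_mul, cnotLayer_unitary]

theorem bellProb_sum {n : ℕ} (ψ : PureState n) : ∑ o, bellProb ψ o = 1 := by
  have key : ∀ f : Bits n × Bits n → ℂ,
      ((∑ o, ‖f o‖ ^ 2 : ℝ) : ℂ) = star f ⬝ᵥ f := by
    intro f
    rw [dotProduct]
    push_cast
    refine Finset.sum_congr rfl fun o _ => ?_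
    rw [Pi.star_apply, Complex.star_def, Complex.conj_mul']
  have h1 : ∑ x, ‖ψ.1 x‖ ^ 2 = 1 := by
    rw [← EuclideanSpace.norm_sq_eq, ψ.2]; norm_num
  have h2 : ∑ p, ‖twoCopy ψ p‖ ^ 2 = 1 := by
    simp only [twoCopy, norm_mul, mul_pow, Fintype.sum_prod_type]
    rw [← Finset.sum_mul_sum, h1, one_mul]
  have h3 : ((∑ o, bellProb ψ o : ℝ) : ℂ) = ((1 : ℝ) : ℂ) := by
    rw [← h2, key]
    simp only [bellProb]
    rw [key, Matrix.star_mulVec, Matrix.dotProduct_mulVec, Matrix.vecMul_vecMul,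
      bellCircuit_unitary, Matrix.vecMul_one]
  exact_mod_cast h3

/-- The distribution of the outcome of one two-copy Bell measurement. -/
def bellPMF {n : ℕ} (ψ : PureState n) : PMF (Bits n × Bits n) :=
  PMF.ofFintype (fun o => ENNReal.ofReal (bellProb ψ o)) (by
    rw [← ENNReal.ofReal_sum_of_nonneg fun o _ => by unfold bellProb; positivity]
    rw [bellProb_sum ψ, ENNReal.ofReal_one])

/-- The eigenvalue of `γ_a ⊗ γ_a` read off from the Bell outcome `(u, v)`, where, with modes
numbered from `0`, `a = (j, 0)` gives `(-1)^(u_j + ∑_{k < j} v_k)` and `a = (j, 1)` gives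
`-(-1)^(u_j + v_j + ∑_{k < j} v_k)`. -/
def bellSign {n : ℕ} (o : Bits n × Bits n) (a : Fin n × Fin 2) : ℝ :=
  if a.2 = 0 then (-1) ^ ((o.1 a.1 : ℕ) + ∑ k ∈ Finset.Iio a.1, (o.2 k : ℕ))
  else -(-1) ^ ((o.1 a.1 : ℕ) + (o.2 a.1 : ℕ) + ∑ k ∈ Finset.Iio a.1, (o.2 k : ℕ))

/-- The single-shot value `X = (∑_a g_a)² / 2` of the Bell measurement. -/
def bellValue {n : ℕ} (o : Bits n × Bits n) : ℝ := (∑ a, bellSign o a) ^ 2 / 2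

/-- The law of the outcomes of `N` independent two-copy Bell measurements. -/
def bellShots {n : ℕ} (ψ : PureState n) (N : ℕ) :
    MeasureTheory.Measure (Fin N → Bits n × Bits n) :=
  MeasureTheory.Measure.pi fun _ => (bellPMF ψ).toMeasure

/-- The test accepts if and only if all shots have the value `0`. -/
def acceptEvent (n N : ℕ) : Set (Fin N → Bits n × Bits n) := {ω | ∀ i, bellValue (ω i) = 0}

/-- The test rejects if and only if at least one shot has a nonzero value. -/
def rejectEvent (n N : ℕ) : Set (Fin N → Bits n × Bits n) := {ω | ∃ i, bellValue (ω i) ≠ 0}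

end GaussTest

end

open GaussTest

namespace GaussTest

/-! ### Pauli and Majorana algebra -/

section

/-! The Bell circuit diagonalises every `γ_a ⊗ γ_a`, with eigenvalue `g_a`
(`bellCircuit_mul_majorana`), so a shot measures `Λ²/2`, where `Λ = ∑_a γ_a ⊗ γ_a`.

Completeness: `Λ` commutes with `ρ ⊗ ρ` for Gaussian `ρ`, because it commutes with `A ⊗ 1 + 1 ⊗ A`
for quadratic `A`. For pure Gaussian `ψ` this makes `ψ ⊗ ψ` an eigenvector of `Λ`. Its eigenvalue is
`∑_a ⟨γ_a⟩²`, which vanishes by parity, so only outcomes with `X = 0` occur (`zeroProb_eq_one`).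

Soundness: `E[g_a g_b] = ⟨γ_a γ_b⟩²` gives `E X = n - ‖cov‖²/2` in the Hilbert–Schmidt norm. An
orthogonal change of modes splits the covariance matrix into 2×2 skew blocks with entries `±l_j`, `0
≤ l_j ≤ 1`, whence `E X = ∑_j (1 - l_j²)`. Each block yields an involution `c_j` with `⟨c_j⟩ = l_j`.
These commute, and their joint `+1` eigenprojection is a pure state, Gaussian as a zero-temperature
limit of Gibbs states. A union bound gives its infidelity with `ψ` as at most `∑_j (1 - l_j)/2 ≤ E X
/ 2` (`exists_gaussian_fidelity_le`).

Since squared trace distance is at most infidelity and `X ≤ 2n²`, it follows that `ε² ≤ E X / 2 ≤ n²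
P(X ≠ 0)`. Independence of the shots then gives the bound with `C = 1` (`bell_test_of_fidelity`). -/

theorem pauliX_mul_self : pauliX * pauliX = 1 := by
  ext i j; fin_cases i <;> fin_cases j <;> simp [pauliX]

theorem pauliY_mul_self : pauliY * pauliY = 1 := by
  ext i j; fin_cases i <;> fin_cases j <;> simp [pauliY]

theorem pauliZ_mul_self : pauliZ * pauliZ = 1 := by
  ext i j; fin_cases i <;> fin_cases j <;> simp [pauliZ]

theorem pauliX_mul_pauliY : pauliX * pauliY = -(pauliY * pauliX) := by
  ext i j; fin_cases i <;> fin_cases j <;> simp [pauliX, pauliY]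

theorem pauliX_mul_pauliZ : pauliX * pauliZ = -(pauliZ * pauliX) := by
  ext i j; fin_cases i <;> fin_cases j <;> simp [pauliX, pauliZ]

theorem pauliY_mul_pauliZ : pauliY * pauliZ = -(pauliZ * pauliY) := by
  ext i j; fin_cases i <;> fin_cases j <;> simp [pauliY, pauliZ]

theorem pauliX_conjTranspose : pauliX.conjTranspose = pauliX := by
  ext i j; fin_cases i <;> fin_cases j <;> simp [pauliX]

theorem pauliY_conjTranspose : pauliY.conjTranspose = pauliY := by
  ext i j; fin_cases i <;> fin_cases j <;> simp [pauliY]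

theorem pauliZ_conjTranspose : pauliZ.conjTranspose = pauliZ := by
  ext i j; fin_cases i <;> fin_cases j <;> simp [pauliZ]

/-- Tensor products anticommute if exactly one pair of factors anticommutes. -/
theorem tensorOp_anticommute {n : ℕ} {A B : Fin n → Matrix (Fin 2) (Fin 2) ℂ} (j : Fin n)
    (hj : A j * B j = -(B j * A j)) (h : ∀ k, k ≠ j → A k * B k = B k * A k) :
    tensorOp A * tensorOp B = -(tensorOp B * tensorOp A) := by
  rw [tensorOp_mul, tensorOp_mul]
  ext x y
  simp only [tensorOp, Matrix.of_apply, Matrix.neg_apply]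
  rw [← Finset.mul_prod_erase _ _ (Finset.mem_univ j),
    ← Finset.mul_prod_erase _ (fun k => (B k * A k) (x k) (y k)) (Finset.mem_univ j), hj,
    Matrix.neg_apply, neg_mul]
  congr 2
  exact Finset.prod_congr rfl fun k hk => by rw [h k (Finset.ne_of_mem_erase hk)]

theorem majorana_mul_self {n : ℕ} (a : Fin n × Fin 2) :
    (majorana a : Op n) * majorana a = 1 := by
  rw [majorana, tensorOp_mul, ← tensorOp_one]
  congr 1
  funext k
  split_ifs <;> simp [pauliX_mul_self, pauliY_mul_self, pauliZ_mul_self]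

theorem majorana_conjTranspose {n : ℕ} (a : Fin n × Fin 2) :
    (majorana a : Op n).conjTranspose = majorana a := by
  rw [majorana, tensorOp_conjTranspose]
  congr 1
  funext k
  split_ifs <;> simp [pauliX_conjTranspose, pauliY_conjTranspose, pauliZ_conjTranspose]

/-- Only at mode `a.1` do the factors fail to commute: there the `X` or `Y` of `a` meets the `Z`
string of `b`. Below it both are `Z`, above it `a` acts trivially. -/
theorem majorana_mul_majorana_of_lt {n : ℕ} {a b : Fin n × Fin 2} (h : a.1 < b.1) :
    (majorana a : Op n) * majorana b = -(majorana b * majorana a) := by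
  refine tensorOp_anticommute a.1 ?_ fun k hk => ?_
  · rw [if_neg (lt_irrefl _), if_pos rfl, if_pos h]
    split_ifs
    exacts [pauliX_mul_pauliZ, pauliY_mul_pauliZ]
  · by_cases h1 : k < a.1
    · rw [if_pos h1, if_pos (h1.trans h)]
    · simp [h1, hk]

theorem majorana_mul_majorana_of_ne {n : ℕ} {a b : Fin n × Fin 2} (h : a ≠ b) :
    (majorana a : Op n) * majorana b = -(majorana b * majorana a) := by
  rcases lt_trichotomy a.1 b.1 with h1 | h1 | h1
  · exact majorana_mul_majorana_of_lt h1
  · refine tensorOp_anticommute a.1 ?_ fun k hk => ?_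
    · have h2 : a.2 ≠ b.2 := fun e => h (Prod.ext h1 e)
      simp only [← h1, lt_irrefl, if_false, if_true]
      by_cases ha : a.2 = 0
      · rw [if_pos ha, if_neg (fun hb => h2 (ha.trans hb.symm)), pauliX_mul_pauliY]
      · rw [if_neg ha, if_pos (by omega), pauliX_mul_pauliY, neg_neg]
    · simp [← h1, hk]
  · rw [majorana_mul_majorana_of_lt h1, neg_neg]

theorem majorana_anticommutator {n : ℕ} (a b : Fin n × Fin 2) :
    (majorana a : Op n) * majorana b + majorana b * majorana a = if a = b then 2 else 0 := by
  split_ifs with h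
  · rw [h, majorana_mul_self, one_add_one_eq_two]
  · rw [majorana_mul_majorana_of_ne h, neg_add_cancel]

/-- The fermion parity operator `Z ⊗ ⋯ ⊗ Z`. -/
noncomputable def parity (n : ℕ) : Op n := tensorOp fun _ => pauliZ

theorem parity_mul_self (n : ℕ) : parity n * parity n = 1 := by
  rw [parity, tensorOp_mul, ← tensorOp_one]
  simp only [pauliZ_mul_self]

theorem majorana_mul_parity {n : ℕ} (a : Fin n × Fin 2) :
    majorana a * parity n = -(parity n * majorana a) := by
  refine tensorOp_anticommute a.1 ?_ fun k hk => ?_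
  · rw [if_neg (lt_irrefl _), if_pos rfl]
    split_ifs
    exacts [pauliX_mul_pauliZ, pauliY_mul_pauliZ]
  · simp only [hk, if_false]
    split_ifs <;> simp

/-! ### Diagonalisation by the Bell transformation -/

/-- The matrix element of the one-mode Bell transformation. -/
noncomputable def bellEntry (u v x y : Fin 2) : ℂ := hadamard u x * if v = x + y then 1 else 0

theorem bellCircuit_apply {n : ℕ} (o p : Bits n × Bits n) :
    bellCircuit n o p = ∏ k, bellEntry (o.1 k) (o.2 k) (p.1 k) (p.2 k) := by
  simp only [bellCircuit, Matrix.mul_apply, cnotLayer, Matrix.of_apply, mul_ite, mul_one, mul_zero,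
    Finset.sum_ite_eq', Finset.mem_univ, if_true, Matrix.kroneckerMap_apply,
    bellEntry]
  rw [tensorOp, Matrix.of_apply, Matrix.one_apply, Finset.prod_ite_zero]
  simp [funext_iff]

/-- Bell states are joint eigenvectors of `X ⊗ X`, `Z ⊗ Z` and `Y ⊗ Y = -(X ⊗ X)(Z ⊗ Z)`; the last
identity explains the extra sign for `Y`. -/
theorem bellEntry_pauliX (u v x y : Fin 2) :
    ∑ s, ∑ t, bellEntry u v s t * (pauliX s x * pauliX t y) = (-1) ^ (u : ℕ) * bellEntry u v x y := by
  fin_cases u <;> fin_cases v <;> fin_cases x <;> fin_cases y <;>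
    simp [bellEntry, pauliX, hadamard, Fin.sum_univ_two]

theorem bellEntry_pauliY (u v x y : Fin 2) :
    ∑ s, ∑ t, bellEntry u v s t * (pauliY s x * pauliY t y) =
      -(-1) ^ ((u : ℕ) + v) * bellEntry u v x y := by
  fin_cases u <;> fin_cases v <;> fin_cases x <;> fin_cases y <;>
    simp [bellEntry, pauliY, hadamard, Fin.sum_univ_two]

theorem bellEntry_pauliZ (u v x y : Fin 2) :
    ∑ s, ∑ t, bellEntry u v s t * (pauliZ s x * pauliZ t y) = (-1) ^ (v : ℕ) * bellEntry u v x y := by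
  fin_cases u <;> fin_cases v <;> fin_cases x <;> fin_cases y <;>
    simp [bellEntry, pauliZ, hadamard, Fin.sum_univ_two]

theorem bellEntry_one (u v x y : Fin 2) :
    ∑ s, ∑ t, bellEntry u v s t * ((1 : Matrix (Fin 2) (Fin 2) ℂ) s x *
      (1 : Matrix (Fin 2) (Fin 2) ℂ) t y) = 1 * bellEntry u v x y := by
  fin_cases u <;> fin_cases v <;> fin_cases x <;> fin_cases y <;>
    simp [bellEntry, hadamard, Matrix.one_apply]

/-- The Bell transformation diagonalises two copies of a tensor product of operators whose two
copies are diagonalised by the one-mode Bell transformation. -/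
theorem bellCircuit_mul_tensorOp {n : ℕ} (A : Fin n → Matrix (Fin 2) (Fin 2) ℂ)
    (s : Fin n → Fin 2 → Fin 2 → ℂ)
    (h : ∀ k u v x y, ∑ i, ∑ j, bellEntry u v i j * (A k i x * A k j y) =
      s k u v * bellEntry u v x y) :
    bellCircuit n * (tensorOp A ⊗ₖ tensorOp A) =
      Matrix.diagonal (fun o => ∏ k, s k (o.1 k) (o.2 k)) * bellCircuit n := by
  ext o p
  rw [Matrix.diagonal_mul, bellCircuit_apply, Matrix.mul_apply, ← Finset.prod_mul_distrib]
  simp only [← h, Matrix.kroneckerMap_apply, tensorOp, Matrix.of_apply, bellCircuit_apply,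
    ← Finset.prod_mul_distrib, Fintype.sum_prod_type]
  rw [Fintype.prod_sum]
  refine Finset.sum_congr rfl fun x _ => ?_
  rw [Fintype.prod_sum]

theorem bellCircuit_mul_majorana {n : ℕ} (a : Fin n × Fin 2) :
    bellCircuit n * (majorana a ⊗ₖ majorana a) =
      Matrix.diagonal (fun o => (bellSign o a : ℂ)) * bellCircuit n := by
  rw [majorana, bellCircuit_mul_tensorOp _ fun k u v =>
    if k < a.1 then (-1) ^ (v : ℕ)
    else if k = a.1 then (if a.2 = 0 then (-1) ^ (u : ℕ) else -(-1) ^ ((u : ℕ) + v)) else 1]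
  · congr 2
    funext o
    have h1 : ∀ c : ℂ, (∏ k, if k < a.1 then (-1) ^ ((o.2 k : Fin 2) : ℕ)
        else if k = a.1 then c else 1) =
        (-1) ^ (∑ k ∈ Finset.Iio a.1, ((o.2 k : Fin 2) : ℕ)) * c := by
      intro c
      rw [Finset.prod_ite, Finset.prod_ite, Finset.prod_pow_eq_pow_sum]
      congr 1
      · congr 1
        refine Finset.sum_congr ?_ fun _ _ => rfl
        ext k; simp
      · rw [Finset.prod_const, Finset.prod_const_one, mul_one, Finset.filter_filter]
        have : ({k | ¬ k < a.1 ∧ k = a.1} : Finset (Fin n)) = {a.1} := by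
          ext k
          simp only [Finset.mem_filter, Finset.mem_univ, true_and, Finset.mem_singleton]
          exact ⟨fun h => h.2, fun h => ⟨h ▸ lt_irrefl _, h⟩⟩
        rw [this, Finset.card_singleton, pow_one]
    -- Freezing `k` to `a.1` in the middle branch makes it a constant, as `h1` requires.
    have h2 : (∏ k, if k < a.1 then (-1 : ℂ) ^ ((o.2 k : Fin 2) : ℕ)
        else if k = a.1 then (if a.2 = 0 then (-1) ^ ((o.1 k : Fin 2) : ℕ)
          else -(-1) ^ (((o.1 k : Fin 2) : ℕ) + (o.2 k : Fin 2))) else 1) =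
        ∏ k, if k < a.1 then (-1 : ℂ) ^ ((o.2 k : Fin 2) : ℕ)
        else if k = a.1 then (if a.2 = 0 then (-1) ^ ((o.1 a.1 : Fin 2) : ℕ)
          else -(-1) ^ (((o.1 a.1 : Fin 2) : ℕ) + (o.2 a.1 : Fin 2))) else 1 := by
      refine Finset.prod_congr rfl fun k _ => ?_
      by_cases hk : k = a.1
      · simp [hk]
      · simp [hk]
    rw [h2, h1, bellSign]
    split_ifs
    · push_cast; ring
    · push_cast; ring
  · intro k u v x y
    split_ifs
    · exact bellEntry_pauliZ u v x y
    · exact bellEntry_pauliX u v x y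
    · exact bellEntry_pauliY u v x y
    · exact bellEntry_one u v x y

end

/-! ### Expectation values and single-shot statistics -/

section

/-- The expectation value `⟨ψ|A|ψ⟩`. -/
noncomputable def expect {n : ℕ} (ψ : PureState n) (A : Op n) : ℂ :=
  star ψ.1.ofLp ⬝ᵥ A.mulVec ψ.1.ofLp

section expect

variable {n : ℕ} (ψ : PureState n)

theorem expect_add (A B : Op n) : expect ψ (A + B) = expect ψ A + expect ψ B := by
  rw [expect, Matrix.add_mulVec, dotProduct_add, expect, expect]

theorem expect_sub (A B : Op n) : expect ψ (A - B) = expect ψ A - expect ψ B := by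
  rw [expect, Matrix.sub_mulVec, dotProduct_sub, expect, expect]

theorem expect_neg (A : Op n) : expect ψ (-A) = -expect ψ A := by
  rw [expect, Matrix.neg_mulVec, dotProduct_neg, expect]

theorem expect_smul (c : ℂ) (A : Op n) : expect ψ (c • A) = c * expect ψ A := by
  rw [expect, Matrix.smul_mulVec, dotProduct_smul, expect, smul_eq_mul]

theorem expect_sum {ι : Type*} (s : Finset ι) (A : ι → Op n) :
    expect ψ (∑ i ∈ s, A i) = ∑ i ∈ s, expect ψ (A i) := by
  simp only [expect, Matrix.sum_mulVec, dotProduct_sum]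

theorem expect_conjTranspose (A : Op n) : expect ψ A.conjTranspose = star (expect ψ A) := by
  rw [expect, Matrix.dotProduct_mulVec, ← Matrix.star_mulVec, Matrix.star_dotProduct, expect]

theorem sum_normSq_eq_one : ∑ x, ‖ψ.1 x‖ ^ 2 = 1 := by
  rw [← EuclideanSpace.norm_sq_eq, ψ.2, one_pow]

theorem star_dotProduct_self {ι : Type*} [Fintype ι] (f : ι → ℂ) :
    star f ⬝ᵥ f = ((∑ i, ‖f i‖ ^ 2 : ℝ) : ℂ) := by
  rw [dotProduct]
  push_cast
  refine Finset.sum_congr rfl fun o _ => ?_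
  rw [Pi.star_apply, Complex.star_def, Complex.conj_mul']

theorem expect_one : expect ψ 1 = 1 := by
  rw [expect, Matrix.one_mulVec, star_dotProduct_self]
  exact_mod_cast sum_normSq_eq_one ψ

theorem expect_conjTranspose_mul_self (A : Op n) :
    expect ψ (A.conjTranspose * A) = ((∑ x, ‖A.mulVec ψ.1.ofLp x‖ ^ 2 : ℝ) : ℂ) := by
  rw [← star_dotProduct_self, expect, Matrix.star_mulVec, ← Matrix.mulVec_mulVec,
    Matrix.dotProduct_mulVec]

theorem kronecker_mulVec_twoCopy (A B : Op n) :
    (A ⊗ₖ B).mulVec (twoCopy ψ) = fun p => A.mulVec ψ.1.ofLp p.1 * B.mulVec ψ.1.ofLp p.2 := by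
  ext p
  simp only [dotProduct, Matrix.mulVec, twoCopy, Fintype.sum_prod_type,
    Matrix.kroneckerMap_apply, Finset.sum_mul_sum]
  exact Finset.sum_congr rfl fun x _ => Finset.sum_congr rfl fun y _ => by ring

theorem twoCopy_expect (A B : Op n) :
    star (twoCopy ψ) ⬝ᵥ (A ⊗ₖ B).mulVec (twoCopy ψ) = expect ψ A * expect ψ B := by
  rw [kronecker_mulVec_twoCopy]
  simp only [expect, dotProduct, twoCopy, Fintype.sum_prod_type, Pi.star_apply, star_mul',
    Finset.sum_mul_sum]
  exact Finset.sum_congr rfl fun x _ => Finset.sum_congr rfl fun y _ => by ring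

end expect

variable {n : ℕ} (ψ : PureState n)

/-- The covariance matrix: `⟨γ_a γ_b⟩ = δ_{ab} + i cov_{ab}`. -/
noncomputable def cov (a b : Fin n × Fin 2) : ℝ := (expect ψ (majorana a * majorana b)).im

/-- For `a ≠ b` the product is anti-Hermitian, so its expectation is purely imaginary. -/
theorem expect_majorana_mul_majorana (a b : Fin n × Fin 2) :
    expect ψ (majorana a * majorana b) = (if a = b then 1 else 0) + Complex.I * cov ψ a b := by
  by_cases h : a = b
  · subst h
    simp [cov, majorana_mul_self, expect_one]
  · have h1 := expect_conjTranspose ψ (majorana a * majorana b)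
    rw [Matrix.conjTranspose_mul, majorana_conjTranspose, majorana_conjTranspose,
      majorana_mul_majorana_of_ne (Ne.symm h), expect_neg] at h1
    have h2 := congrArg Complex.re h1
    simp only [Complex.neg_re, Complex.star_def, Complex.conj_re] at h2
    rw [if_neg h, cov]
    apply Complex.ext
    · simp; linarith
    · simp

theorem cov_self (a : Fin n × Fin 2) : cov ψ a a = 0 := by
  rw [cov, majorana_mul_self, expect_one, Complex.one_im]

theorem cov_swap (a b : Fin n × Fin 2) : cov ψ b a = -cov ψ a b := by
  by_cases h : a = b
  · rw [h, cov_self, neg_zero]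
  · rw [cov, majorana_mul_majorana_of_ne (Ne.symm h), expect_neg, Complex.neg_im, cov]

/-- The correlation of two signs is the two-copy expectation of `γ_a γ_b ⊗ γ_a γ_b`, hence the
square of a one-copy expectation. The minus sign is the square of the `i` in front of `cov`. -/
theorem sum_bellProb_mul_bellSign (a b : Fin n × Fin 2) :
    ∑ o, bellProb ψ o * (bellSign o a * bellSign o b) =
      (if a = b then 1 else 0) - cov ψ a b ^ 2 := by
  have h1 : ((∑ o, bellProb ψ o * (bellSign o a * bellSign o b) : ℝ) : ℂ) =
      expect ψ (majorana a * majorana b) * expect ψ (majorana a * majorana b) := by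
    rw [← twoCopy_expect, Matrix.mul_kronecker_mul]
    have h2 : bellCircuit n * ((majorana a ⊗ₖ majorana a) * (majorana b ⊗ₖ majorana b)) =
        Matrix.diagonal (fun o => (bellSign o a * bellSign o b : ℂ)) * bellCircuit n := by
      rw [← Matrix.mul_assoc, bellCircuit_mul_majorana, Matrix.mul_assoc, bellCircuit_mul_majorana,
        ← Matrix.mul_assoc, Matrix.diagonal_mul_diagonal]
    have h3 : (majorana a ⊗ₖ majorana a) * (majorana b ⊗ₖ majorana b) =
        (bellCircuit n).conjTranspose *
          (Matrix.diagonal (fun o => (bellSign o a * bellSign o b : ℂ)) * bellCircuit n) := by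
      rw [← h2, ← Matrix.mul_assoc, bellCircuit_unitary, Matrix.one_mul]
    rw [h3, ← Matrix.mulVec_mulVec, Matrix.dotProduct_mulVec, ← Matrix.star_mulVec,
      ← Matrix.mulVec_mulVec, dotProduct]
    push_cast
    refine Finset.sum_congr rfl fun o _ => ?_
    rw [Matrix.mulVec_diagonal, bellProb, Pi.star_apply, Complex.star_def]
    push_cast
    rw [← Complex.conj_mul']
    ring
  rw [expect_majorana_mul_majorana] at h1
  by_cases h : a = b
  · subst h
    rw [cov_self] at h1 ⊢
    simp only [if_true, Complex.ofReal_zero, mul_zero, add_zero, mul_one] at h1 ⊢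
    rw [show (1 : ℝ) - 0 ^ 2 = 1 by norm_num]
    exact_mod_cast h1
  · rw [if_neg h] at h1 ⊢
    have h4 : (0 + Complex.I * cov ψ a b) * (0 + Complex.I * cov ψ a b) =
        ((0 - cov ψ a b ^ 2 : ℝ) : ℂ) := by
      push_cast
      linear_combination (cov ψ a b : ℂ) ^ 2 * Complex.I_mul_I
    rw [h4] at h1
    exact_mod_cast h1

/-- The mean of the single-shot value. -/
theorem sum_bellProb_mul_bellValue :
    ∑ o, bellProb ψ o * bellValue o = n - (∑ a, ∑ b, cov ψ a b ^ 2) / 2 := by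
  have h1 : ∀ o : Bits n × Bits n, bellProb ψ o * bellValue o =
      (∑ a, ∑ b, bellProb ψ o * (bellSign o a * bellSign o b)) / 2 := by
    intro o
    rw [bellValue, sq, Finset.sum_mul_sum, mul_div_assoc', Finset.mul_sum]
    simp only [Finset.mul_sum]
  simp only [h1]
  rw [← Finset.sum_div, Finset.sum_comm]
  simp only [Finset.sum_comm (s := (Finset.univ : Finset (Bits n × Bits n))),
    sum_bellProb_mul_bellSign, Finset.sum_sub_distrib, Finset.sum_ite_eq, Finset.mem_univ, if_true]
  simp
  ring

theorem abs_bellSign (o : Bits n × Bits n) (a : Fin n × Fin 2) : |bellSign o a| = 1 := by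
  rw [bellSign]
  split_ifs
  · rw [abs_pow]; simp
  · rw [abs_neg, abs_pow]; simp

theorem bellValue_le (o : Bits n × Bits n) : bellValue o ≤ 2 * n ^ 2 := by
  have h : |∑ a, bellSign o a| ≤ 2 * n := by
    refine (Finset.abs_sum_le_sum_abs _ _).trans ?_
    simp [abs_bellSign, mul_comm]
  have h2 := sq_le_sq' (abs_le.1 h).1 (abs_le.1 h).2
  rw [bellValue]
  linarith [mul_pow (2 : ℝ) n 2]

theorem bellProb_nonneg (o : Bits n × Bits n) : 0 ≤ bellProb ψ o := by
  unfold bellProb; positivity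

open scoped Classical in
/-- The probability that a single Bell measurement has the value `0`. -/
noncomputable def zeroProb : ℝ := ∑ o with bellValue o = 0, bellProb ψ o

theorem zeroProb_nonneg : 0 ≤ zeroProb ψ := Finset.sum_nonneg fun o _ => bellProb_nonneg ψ o

/-- Markov's inequality in reverse: the value is zero on accepted outcomes and at most `2n²` on the
others, so a large mean forces a large rejection probability. -/
theorem sum_bellProb_mul_bellValue_le :
    ∑ o, bellProb ψ o * bellValue o ≤ 2 * n ^ 2 * (1 - zeroProb ψ) := by
  classical
  rw [← bellProb_sum ψ, zeroProb, ← Finset.sum_filter_add_sum_filter_not Finset.univ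
    (fun o : Bits n × Bits n => bellValue o = 0),
    ← Finset.sum_filter_add_sum_filter_not Finset.univ
    (fun o : Bits n × Bits n => bellValue o = 0) (fun o => bellProb ψ o)]
  rw [Finset.sum_eq_zero (s := Finset.univ.filter fun o : Bits n × Bits n => bellValue o = 0)
    (f := fun o => bellProb ψ o * bellValue o)
    (fun o ho => by rw [(Finset.mem_filter.1 ho).2, mul_zero]), zero_add, add_comm, add_sub_assoc]
  -- The two sums to be cancelled range over the same filter, possibly with different decidability
  -- instances; `congr` identifies them.
  have : ∀ x y z : ℝ, x = y → z + (x - y) = z := fun x y z h => by rw [h]; ring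
  rw [this _ _ _ (by congr), Finset.mul_sum]
  refine Finset.sum_le_sum fun o _ => ?_
  rw [mul_comm]
  exact mul_le_mul_of_nonneg_right (bellValue_le o) (bellProb_nonneg ψ o)

open MeasureTheory in
theorem bellShots_real_acceptEvent (N : ℕ) :
    (bellShots ψ N).real (acceptEvent n N) = zeroProb ψ ^ N := by
  classical
  have h1 : acceptEvent n N = Set.pi Set.univ fun _ => {o : Bits n × Bits n | bellValue o = 0} := by
    ext ω; simp [acceptEvent]
  have h2 : (bellPMF ψ).toMeasure {o : Bits n × Bits n | bellValue o = 0} =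
      ENNReal.ofReal (zeroProb ψ) := by
    rw [PMF.toMeasure_apply_fintype _ _, zeroProb,
      ENNReal.ofReal_sum_of_nonneg fun o _ => bellProb_nonneg ψ o, Finset.sum_filter]
    refine Finset.sum_congr rfl fun o _ => ?_
    simp only [Set.indicator_apply, Set.mem_ofPred_eq, bellPMF, PMF.ofFintype_apply]
  rw [h1, Measure.real, bellShots, Measure.pi_pi, h2]
  rw [Finset.prod_const, Finset.card_univ, Fintype.card_fin, ENNReal.toReal_pow,
    ENNReal.toReal_ofReal (zeroProb_nonneg ψ)]

open MeasureTheory in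
theorem bellShots_real_rejectEvent (N : ℕ) :
    (bellShots ψ N).real (rejectEvent n N) = 1 - zeroProb ψ ^ N := by
  have h1 : rejectEvent n N = (acceptEvent n N)ᶜ := by
    ext ω; simp [acceptEvent, rejectEvent]
  have : IsProbabilityMeasure (bellShots ψ N) := by unfold bellShots; infer_instance
  rw [h1, probReal_compl_eq_one_sub (Set.toFinite _).measurableSet, bellShots_real_acceptEvent]

end

/-! ### Gaussian states are always accepted -/

section

variable {n : ℕ}

/-- Bravyi's operator `∑ₐ γₐ ⊗ γₐ`. -/
noncomputable def bravyi (n : ℕ) : Matrix (Bits n × Bits n) (Bits n × Bits n) ℂ :=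
  ∑ a : Fin n × Fin 2, majorana a ⊗ₖ majorana a

/-- The ring homomorphism `A ↦ A ⊗ 1`. -/
def kroneckerOne (n : ℕ) : Op n →+* Matrix (Bits n × Bits n) (Bits n × Bits n) ℂ where
  toFun A := A ⊗ₖ (1 : Op n)
  map_one' := Matrix.one_kronecker_one
  map_mul' A B := by rw [← Matrix.mul_kronecker_mul, one_mul]
  map_zero' := Matrix.zero_kronecker _
  map_add' A B := Matrix.add_kronecker _ _ _

/-- The ring homomorphism `A ↦ 1 ⊗ A`. -/
def oneKronecker (n : ℕ) : Op n →+* Matrix (Bits n × Bits n) (Bits n × Bits n) ℂ where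
  toFun A := (1 : Op n) ⊗ₖ A
  map_one' := Matrix.one_kronecker_one
  map_mul' A B := by rw [← Matrix.mul_kronecker_mul, one_mul]
  map_zero' := Matrix.kronecker_zero _
  map_add' A B := Matrix.kronecker_add _ _ _

theorem continuous_kronecker {X : Type*} [TopologicalSpace X] {f g : X → Op n} (hf : Continuous f)
    (hg : Continuous g) : Continuous fun x => f x ⊗ₖ g x :=
  continuous_matrix fun i j => (hf.matrix_elem i.1 j.1).mul (hg.matrix_elem i.2 j.2)

open scoped Matrix.Norms.Operator in
theorem map_matrix_exp {m : Type*} [Fintype m] [DecidableEq m]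
    (f : Op n →+* Matrix m m ℂ) (hf : Continuous f) (A : Op n) :
    f (NormedSpace.exp A) = NormedSpace.exp (f A) :=
  NormedSpace.map_exp f hf A

theorem exp_kronecker_exp (A : Op n) :
    NormedSpace.exp A ⊗ₖ NormedSpace.exp A =
      NormedSpace.exp (kroneckerOne n A + oneKronecker n A) := by
  have h : Commute (kroneckerOne n A) (oneKronecker n A) := by
    change (A ⊗ₖ (1 : Op n)) * ((1 : Op n) ⊗ₖ A) = ((1 : Op n) ⊗ₖ A) * (A ⊗ₖ (1 : Op n))
    rw [← Matrix.mul_kronecker_mul, ← Matrix.mul_kronecker_mul, one_mul, mul_one]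
  rw [Matrix.exp_add_of_commute _ _ h,
    ← map_matrix_exp _ (continuous_kronecker continuous_id continuous_const),
    ← map_matrix_exp _ (continuous_kronecker continuous_const continuous_id)]
  change _ = (_ ⊗ₖ (1 : Op n)) * ((1 : Op n) ⊗ₖ _)
  rw [← Matrix.mul_kronecker_mul, one_mul, mul_one]

/-- From `[ab, c] = a{b, c} - {a, c}b`: quadratic operators act linearly on the Majorana operators.
-/
theorem majorana_pair_commutator (a b c : Fin n × Fin 2) :
    (majorana a * majorana b : Op n) * majorana c - majorana c * (majorana a * majorana b) =
      (if b = c then (2 : ℂ) else 0) • majorana a - (if a = c then (2 : ℂ) else 0) • majorana b := by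
  have h1 := majorana_anticommutator b c
  have h2 := majorana_anticommutator a c
  have h : (majorana a * majorana b : Op n) * majorana c - majorana c * (majorana a * majorana b) =
      majorana a * (majorana b * majorana c + majorana c * majorana b) -
        (majorana a * majorana c + majorana c * majorana a) * majorana b := by
    noncomm_ring
  rw [h, h1, h2]
  congr 1
  · split_ifs
    · rw [two_smul, mul_two]
    · rw [mul_zero, zero_smul]
  · split_ifs
    · rw [two_smul, two_mul]
    · rw [zero_mul, zero_smul]

theorem sub_kronecker (A B C : Op n) : (A - B) ⊗ₖ C = A ⊗ₖ C - B ⊗ₖ C := by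
  rw [eq_sub_iff_add_eq, ← Matrix.add_kronecker, sub_add_cancel]

theorem kronecker_sub (A B C : Op n) : A ⊗ₖ (B - C) = A ⊗ₖ B - A ⊗ₖ C := by
  rw [eq_sub_iff_add_eq, ← Matrix.kronecker_add, sub_add_cancel]

/-- Summed over `c`, the commutators give `2(γ_a ⊗ γ_b - γ_b ⊗ γ_a)` from the first copy and the
opposite from the second: `Λ` is invariant under rotations of the modes. -/
theorem commute_bravyi_pair (a b : Fin n × Fin 2) :
    Commute (kroneckerOne n (majorana a * majorana b) + oneKronecker n (majorana a * majorana b))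
      (bravyi n) := by
  have h : ∀ (A : Op n) (c : Fin n × Fin 2), (kroneckerOne n A + oneKronecker n A) *
      (majorana c ⊗ₖ majorana c) - (majorana c ⊗ₖ majorana c) *
        (kroneckerOne n A + oneKronecker n A) =
      (A * majorana c - majorana c * A) ⊗ₖ majorana c +
        majorana c ⊗ₖ (A * majorana c - majorana c * A) := by
    intro A c
    change (A ⊗ₖ (1 : Op n) + (1 : Op n) ⊗ₖ A) * _ - _ * (A ⊗ₖ (1 : Op n) + (1 : Op n) ⊗ₖ A) = _
    rw [add_mul, mul_add, sub_kronecker, kronecker_sub]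
    simp only [← Matrix.mul_kronecker_mul, one_mul, mul_one]
    abel
  rw [commute_iff_eq, ← sub_eq_zero, bravyi, Finset.mul_sum, Finset.sum_mul,
    ← Finset.sum_sub_distrib]
  simp only [h, majorana_pair_commutator, sub_kronecker, kronecker_sub, Matrix.smul_kronecker,
    Matrix.kronecker_smul, Finset.sum_add_distrib, Finset.sum_sub_distrib]
  simp only [ite_smul, zero_smul, Finset.sum_ite_eq, Finset.mem_univ, if_true]
  abel

theorem commute_bravyi_exp (K : Matrix (Fin n × Fin 2) (Fin n × Fin 2) ℝ) :
    Commute (NormedSpace.exp (quadraticExponent K) ⊗ₖ NormedSpace.exp (quadraticExponent K))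
      (bravyi n) := by
  rw [exp_kronecker_exp]
  refine (Commute.exp_right ?_).symm
  have h1 : ∀ (c : ℂ) (A : Op n), Commute (kroneckerOne n A + oneKronecker n A) (bravyi n) →
      Commute (kroneckerOne n (c • A) + oneKronecker n (c • A)) (bravyi n) := by
    intro c A hA
    have : kroneckerOne n (c • A) + oneKronecker n (c • A) =
        c • (kroneckerOne n A + oneKronecker n A) := by
      rw [smul_add]
      exact congrArg₂ _ (Matrix.smul_kronecker _ _ _) (Matrix.kronecker_smul _ _ _)
    rw [this]
    exact hA.smul_left c
  have h2 : ∀ (A : Fin n × Fin 2 → Op n),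
      (∀ i, Commute (kroneckerOne n (A i) + oneKronecker n (A i)) (bravyi n)) →
      Commute (kroneckerOne n (∑ i, A i) + oneKronecker n (∑ i, A i)) (bravyi n) := by
    intro A hA
    rw [map_sum, map_sum, ← Finset.sum_add_distrib]
    exact Commute.sum_left _ _ _ fun i _ => hA i
  exact (h1 _ _ (h2 _ fun a => h2 _ fun b => h1 _ _ (commute_bravyi_pair a b))).symm

/-- Commutation is a closed condition, so it passes from Gibbs states to their limits. -/
theorem commute_bravyi_of_mem_gaussianStates {ρ : Op n} (hρ : ρ ∈ gaussianStates n) :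
    Commute (ρ ⊗ₖ ρ) (bravyi n) := by
  have hc : IsClosed {ρ : Op n | (ρ ⊗ₖ ρ) * bravyi n = bravyi n * (ρ ⊗ₖ ρ)} := by
    have := continuous_kronecker (n := n) continuous_id continuous_id
    exact isClosed_eq (this.mul continuous_const) (continuous_const.mul this)
  refine closure_minimal ?_ hc hρ
  rintro _ ⟨K, -, rfl⟩
  change Commute _ _
  rw [gibbsState, Matrix.smul_kronecker, Matrix.kronecker_smul]
  exact ((commute_bravyi_exp K).smul_left _).smul_left _

theorem commute_parity_of_mem_gaussianStates {ρ : Op n} (hρ : ρ ∈ gaussianStates n) :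
    Commute ρ (parity n) := by
  have hc : IsClosed {ρ : Op n | ρ * parity n = parity n * ρ} :=
    isClosed_eq (continuous_id.mul continuous_const) (continuous_const.mul continuous_id)
  refine closure_minimal ?_ hc hρ
  rintro _ ⟨K, -, rfl⟩
  refine Commute.smul_left (Commute.symm (Commute.exp_right (Commute.symm ?_))) _
  refine Commute.smul_left (Commute.sum_left _ _ _ fun a _ => Commute.sum_left _ _ _ fun b _ =>
    Commute.smul_left ?_ _) _
  rw [commute_iff_eq, mul_assoc, majorana_mul_parity, mul_neg, ← mul_assoc, majorana_mul_parity,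
    neg_mul, neg_neg, mul_assoc]

theorem density_eq_vecMulVec (ψ : PureState n) :
    ψ.density = Matrix.vecMulVec ψ.1.ofLp (star ψ.1.ofLp) := rfl

theorem expect_eq_trace (ψ : PureState n) (A : Op n) :
    expect ψ A = Matrix.trace (A * ψ.density) := by
  rw [density_eq_vecMulVec, Matrix.mul_vecMulVec, Matrix.trace_vecMulVec, expect, dotProduct_comm]

/-- Conjugation by the parity fixes the state and negates `γ_a`. -/
theorem expect_majorana_eq_zero {ψ : PureState n} (h : Commute ψ.density (parity n))
    (a : Fin n × Fin 2) : expect ψ (majorana a) = 0 := by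
  have h1 : Matrix.trace (majorana a * ψ.density) = -Matrix.trace (majorana a * ψ.density) := by
    calc Matrix.trace (majorana a * ψ.density)
        = Matrix.trace (majorana a * (parity n * (parity n * ψ.density))) := by
          rw [← mul_assoc (parity n), parity_mul_self, one_mul]
      _ = Matrix.trace ((majorana a * parity n) * (ψ.density * parity n)) := by
          rw [h.eq, mul_assoc]
      _ = Matrix.trace ((parity n * (majorana a * parity n)) * ψ.density) := by
          rw [← mul_assoc, Matrix.trace_mul_comm, ← mul_assoc (parity n)]
      _ = _ := by
          rw [majorana_mul_parity, mul_neg, ← mul_assoc, parity_mul_self, one_mul, neg_mul,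
            Matrix.trace_neg]
  rw [expect_eq_trace]
  linear_combination h1 / 2

/-- A vector whose rank-one projection commutes with `Λ` is an eigenvector, with eigenvalue the
expectation of `Λ`, here `∑_a ⟨γ_a⟩² = 0`. -/
theorem bravyi_mulVec_twoCopy {ψ : PureState n} (h : ψ ∈ pureGaussianStates n) :
    (bravyi n).mulVec (twoCopy ψ) = 0 := by
  have h1 := commute_bravyi_of_mem_gaussianStates h
  have h2 := commute_parity_of_mem_gaussianStates h
  have h3 : ψ.density ⊗ₖ ψ.density = Matrix.vecMulVec (twoCopy ψ) (star (twoCopy ψ)) := by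
    ext p q
    simp [PureState.density, twoCopy, Matrix.vecMulVec_apply]
    ring
  have h4 : star (twoCopy ψ) ⬝ᵥ twoCopy ψ = 1 := by
    have := twoCopy_expect ψ 1 1
    rwa [Matrix.one_kronecker_one, Matrix.one_mulVec, expect_one, one_mul] at this
  have h5 : star (twoCopy ψ) ⬝ᵥ (bravyi n).mulVec (twoCopy ψ) = 0 := by
    rw [bravyi, Matrix.sum_mulVec, dotProduct_sum]
    exact Finset.sum_eq_zero fun a _ => by
      rw [twoCopy_expect, expect_majorana_eq_zero h2, zero_mul]
  have h6 := congrArg (fun M => M.mulVec (twoCopy ψ)) h1.eq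
  simp only [h3, ← Matrix.mulVec_mulVec, Matrix.vecMulVec_mulVec, h4, h5] at h6
  simpa using h6.symm

/-- A pure Gaussian state passes every Bell test. -/
theorem zeroProb_eq_one {ψ : PureState n} (h : ψ ∈ pureGaussianStates n) : zeroProb ψ = 1 := by
  classical
  have h1 : bellCircuit n * bravyi n =
      Matrix.diagonal (fun o => ((∑ a, bellSign o a : ℝ) : ℂ)) * bellCircuit n := by
    rw [bravyi, Finset.mul_sum]
    simp only [bellCircuit_mul_majorana]
    rw [← Finset.sum_mul]
    congr 1
    ext i j
    by_cases hij : i = j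
    · subst hij; simp [Matrix.sum_apply]
    · simp [Matrix.sum_apply, hij]
  have h2 := congrArg (fun M => M.mulVec (twoCopy ψ)) h1
  simp only [← Matrix.mulVec_mulVec, bravyi_mulVec_twoCopy h, Matrix.mulVec_zero] at h2
  rw [← bellProb_sum ψ, zeroProb]
  refine Finset.sum_subset (Finset.subset_univ _) fun o _ ho => ?_
  have h3 := congrFun h2 o
  rw [Matrix.mulVec_diagonal, Pi.zero_apply, eq_comm, mul_eq_zero] at h3
  rcases h3 with h3 | h3
  · refine absurd (Finset.mem_filter.2 ⟨Finset.mem_univ _, ?_⟩) ho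
    rw [bellValue, Complex.ofReal_eq_zero.1 h3]
    norm_num
  · rw [bellProb, h3, norm_zero]
    norm_num

end

/-! ### Normal form of skew-adjoint maps -/

section

open Module

/-- The normal form of a skew-adjoint map on a real inner product space of even dimension. -/
theorem exists_orthonormal_skew_normalForm (n : ℕ) :
    ∀ {E : Type} [NormedAddCommGroup E] [InnerProductSpace ℝ E] [FiniteDimensional ℝ E]
      (_ : finrank ℝ E = n * 2) (T : E →ₗ[ℝ] E) (_ : ∀ x y, inner ℝ (T x) y = -inner ℝ x (T y)),
      ∃ (b : Fin n × Fin 2 → E) (l : Fin n → ℝ), Orthonormal ℝ b ∧ (∀ j, 0 ≤ l j) ∧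
        (∀ j, T (b (j, 0)) = l j • b (j, 1)) ∧ ∀ j, T (b (j, 1)) = -(l j • b (j, 0)) := by
  induction n with
  | zero =>
    intro E _ _ _ _ T _
    exact ⟨fun j => j.1.elim0, fun j => j.elim0, ⟨fun j => j.1.elim0, fun j => j.1.elim0⟩,
      fun j => j.elim0, fun j => j.elim0, fun j => j.elim0⟩
  | succ n ih =>
    intro E _ _ _ hE T hT
    by_cases h0 : T = 0
    · let B := (stdOrthonormalBasis ℝ E).reindex
        (Fintype.equivOfCardEq (by simp [hE]) : Fin (finrank ℝ E) ≃ Fin (n + 1) × Fin 2)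
      exact ⟨B, 0, B.orthonormal, fun _ => le_rfl, fun j => by simp [h0], fun j => by simp [h0]⟩
    have hsym : (T ∘ₗ T).IsSymmetric := fun x y => by
      rw [LinearMap.comp_apply, LinearMap.comp_apply, hT, hT, neg_neg]
    -- The symmetric map `T²` has an eigenvector outside its kernel: if `T² = 0`, then `‖T x‖² =
    -- -⟨x, T² x⟩ = 0` for all `x`, contradicting `T ≠ 0`.
    obtain ⟨i, hi⟩ : ∃ i, T (T (hsym.eigenvectorBasis rfl i)) ≠ 0 := by
      by_contra! hc
      have h1 : T ∘ₗ T = 0 := (hsym.eigenvectorBasis rfl).toBasis.ext fun i => by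
        rw [OrthonormalBasis.coe_toBasis, LinearMap.comp_apply, hc, LinearMap.zero_apply]
      refine h0 (LinearMap.ext fun x => ?_)
      have h2 := hT x (T x)
      have h3 : T (T x) = 0 := LinearMap.congr_fun h1 x
      rw [h3, inner_zero_right, neg_zero] at h2
      simpa using h2
    obtain ⟨v, hv1, μ, hμ, hTv⟩ : ∃ v : E, ‖v‖ = 1 ∧ ∃ μ : ℝ, T v ≠ 0 ∧ T (T v) = μ • v :=
      ⟨_, (hsym.eigenvectorBasis rfl).orthonormal.1 i, hsym.eigenvalues rfl i,
        fun h => hi (by rw [h, map_zero]), by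
          have := hsym.apply_eigenvectorBasis rfl i
          simpa only [LinearMap.comp_apply, RCLike.ofReal_real_eq_id, id] using this⟩
    have hl : 0 < ‖T v‖ := norm_pos_iff.2 hμ
    have hμ2 : μ = -‖T v‖ ^ 2 := by
      have h1 := hT (T v) v
      rw [hTv, inner_smul_left, real_inner_self_eq_norm_sq, real_inner_self_eq_norm_sq, hv1] at h1
      simpa using h1
    -- The plane spanned by `v` and `w` carries one block, with `l = ‖T v‖`. By skewness its
    -- orthogonal complement is again invariant, and the induction continues there.
    set w : E := ‖T v‖⁻¹ • T v with hw
    have hTv' : T v = ‖T v‖ • w := by rw [hw, smul_inv_smul₀ hl.ne']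
    have hTw : T w = -(‖T v‖ • v) := by
      rw [hw, map_smul, hTv, hμ2, smul_smul, ← neg_smul]
      congr 1
      field_simp
    have hw1 : ‖w‖ = 1 := by
      rw [hw, norm_smul, norm_inv, norm_norm, inv_mul_cancel₀ hl.ne']
    have hvw : inner ℝ v w = 0 := by
      have h1 := hT v v
      rw [real_inner_comm] at h1
      rw [hw, inner_smul_right, show inner ℝ v (T v) = 0 by linarith, mul_zero]
    have hort : Orthonormal ℝ ![v, w] := by
      rw [orthonormal_iff_ite]
      intro i j
      fin_cases i <;> fin_cases j <;>
        simp [hv1, hw1, hvw, real_inner_comm v w]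
    let U : Submodule ℝ E := (Submodule.span ℝ (Set.range ![v, w]))ᗮ
    have hU : ∀ {x}, x ∈ U ↔ inner ℝ v x = 0 ∧ inner ℝ w x = 0 := by
      intro x
      simp only [U, Submodule.mem_orthogonal]
      constructor
      · intro h
        exact ⟨h v (Submodule.subset_span ⟨0, rfl⟩), h w (Submodule.subset_span ⟨1, rfl⟩)⟩
      · rintro ⟨h1, h2⟩ u hu
        induction hu using Submodule.span_induction with
        | mem u hu =>
          obtain ⟨k, rfl⟩ := hu
          fin_cases k
          exacts [h1, h2]
        | zero => exact inner_zero_left _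
        | add a b _ _ ha hb => rw [inner_add_left, ha, hb, add_zero]
        | smul c a _ ha => rw [inner_smul_left, ha, mul_zero]
    have hTU : ∀ x ∈ U, T x ∈ U := by
      intro x hx
      rw [hU] at hx ⊢
      constructor
      · have := hT v x
        rw [hTv', inner_smul_left, hx.2, mul_zero] at this
        linarith
      · have := hT w x
        rw [hTw, inner_neg_left, inner_smul_left, hx.1, mul_zero] at this
        linarith
    have hfin : finrank ℝ U = n * 2 := by
      have h1 := Submodule.finrank_add_finrank_orthogonal (Submodule.span ℝ (Set.range ![v, w]))
      rw [finrank_span_eq_card hort.linearIndependent, hE, Fintype.card_fin] at h1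
      change 2 + finrank ℝ U = _ at h1
      omega
    obtain ⟨b, l, hb, hl0, hb0, hb1⟩ := ih hfin (T.restrict hTU) fun x y => hT x y
    refine ⟨fun p => Fin.cases (motive := fun _ => E) (![v, w] p.2) (fun j => b (j, p.2)) p.1,
      Fin.cons ‖T v‖ l, ?_, ?_, ?_, ?_⟩
    · rw [orthonormal_iff_ite] at hb hort ⊢
      have hUb : ∀ i k, inner ℝ (![v, w] i) (b k : E) = 0 := by
        intro i k
        have := hU.1 (b k).2
        fin_cases i
        exacts [this.1, this.2]
      rintro ⟨i, s⟩ ⟨j, t⟩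
      induction i using Fin.cases with
      | zero =>
        induction j using Fin.cases with
        | zero => simpa using hort s t
        | succ j => simpa [(Fin.succ_ne_zero j).symm] using hUb s (j, t)
      | succ i =>
        induction j using Fin.cases with
        | zero =>
          have := hUb t (i, s)
          rw [real_inner_comm] at this
          simpa [Fin.succ_ne_zero] using this
        | succ j => simpa using hb (i, s) (j, t)
    · intro j
      induction j using Fin.cases with
      | zero => simp
      | succ j => simpa using hl0 j
    · intro j
      induction j using Fin.cases with
      | zero => simpa using hTv'
      | succ j => simpa using congrArg Subtype.val (hb0 j)
    · intro j
      induction j using Fin.cases with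
      | zero => simpa using hTw
      | succ j => simpa using congrArg Subtype.val (hb1 j)

end

/-! ### Trace distance, fidelity and the sample bound -/

section

variable {n : ℕ}

theorem rank_le_two_of_vecMulVec_sub {ι : Type*} [Fintype ι] (u v w z : ι → ℂ) :
    (Matrix.vecMulVec u v - Matrix.vecMulVec w z).rank ≤ 2 := by
  have h : ∀ A B : Matrix ι ι ℂ, (A - B).rank ≤ A.rank + B.rank := by
    intro A B
    refine (Submodule.finrank_mono ?_).trans (Submodule.finrank_add_le_finrank_add_finrank _ _)
    rintro _ ⟨x, rfl⟩
    rw [Matrix.mulVecLin_apply, Matrix.sub_mulVec]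
    exact Submodule.sub_mem _ (Submodule.mem_sup_left ⟨x, rfl⟩) (Submodule.mem_sup_right ⟨x, rfl⟩)
  exact (h _ _).trans (add_le_add (Matrix.rank_vecMulVec_le _ _) (Matrix.rank_vecMulVec_le _ _))

-- Cauchy–Schwarz over the nonzero singular values, whose number is the rank.
open scoped ComplexOrder in
theorem traceNorm_sq_le (A : Op n) :
    traceNorm A ^ 2 ≤ A.rank * (Matrix.trace (A.conjTranspose * A)).re := by
  classical
  set hA := Matrix.isHermitian_conjTranspose_mul_self A
  have hpos : ∀ i, 0 ≤ hA.eigenvalues i :=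
    (Matrix.posSemidef_conjTranspose_mul_self A).eigenvalues_nonneg
  have h1 : traceNorm A = ∑ i with hA.eigenvalues i ≠ 0, √(hA.eigenvalues i) := by
    rw [traceNorm, Finset.sum_filter]
    refine Finset.sum_congr rfl fun i _ => ?_
    split_ifs with h
    · rfl
    · rw [not_not.1 h, Real.sqrt_zero]
  have h2 : (A.rank : ℝ) = (Finset.univ.filter fun i => hA.eigenvalues i ≠ 0).card := by
    rw [← Matrix.rank_conjTranspose_mul_self, hA.rank_eq_card_non_zero_eigs, Fintype.card_subtype]
  have h3 : (Matrix.trace (A.conjTranspose * A)).re = ∑ i, hA.eigenvalues i := by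
    rw [hA.trace_eq_sum_eigenvalues]
    simp
  rw [h1, h2, h3]
  refine (sq_sum_le_card_mul_sum_sq).trans (mul_le_mul_of_nonneg_left ?_ (Nat.cast_nonneg _))
  simp only [Real.sq_sqrt (hpos _)]
  exact Finset.sum_le_sum_of_subset_of_nonneg (Finset.subset_univ _) fun i _ _ => hpos i

theorem traceNorm_nonneg (A : Op n) : 0 ≤ traceNorm A :=
  Finset.sum_nonneg fun _ _ => Real.sqrt_nonneg _

theorem density_conjTranspose (ψ : PureState n) : ψ.density.conjTranspose = ψ.density := by
  rw [density_eq_vecMulVec, Matrix.conjTranspose_vecMulVec, star_star]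

theorem trace_density (ψ : PureState n) : Matrix.trace ψ.density = 1 := by
  rw [← one_mul ψ.density, ← expect_eq_trace, expect_one]

theorem expect_density_self (ψ : PureState n) : expect ψ ψ.density = 1 := by
  have h : star ψ.1.ofLp ⬝ᵥ ψ.1.ofLp = 1 := by
    rw [← expect_one ψ, expect, Matrix.one_mulVec]
  rw [expect, density_eq_vecMulVec, Matrix.vecMulVec_mulVec, dotProduct_smul, h]
  simp

-- The difference of two pure states has rank at most 2 and squared Hilbert–Schmidt norm `2 - 2F`,
-- so its squared trace norm is at most `4(1 - F)`.
open scoped ComplexOrder in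
theorem traceDistance_sq_le (ψ φ : PureState n) :
    traceDistance ψ.density φ.density ^ 2 ≤ 1 - (expect ψ φ.density).re := by
  have h1 := traceNorm_sq_le (ψ.density - φ.density)
  have h2 : Matrix.trace ((ψ.density - φ.density).conjTranspose * (ψ.density - φ.density)) =
      2 - 2 * expect ψ φ.density := by
    rw [Matrix.conjTranspose_sub, density_conjTranspose, density_conjTranspose, sub_mul, mul_sub,
      mul_sub, Matrix.trace_sub, Matrix.trace_sub, Matrix.trace_sub,
      Matrix.trace_mul_comm ψ.density φ.density, ← expect_eq_trace, ← expect_eq_trace,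
      ← expect_eq_trace, expect_density_self, expect_density_self]
    ring
  have h3 : ((ψ.density - φ.density).rank : ℝ) ≤ 2 := by
    exact_mod_cast rank_le_two_of_vecMulVec_sub _ _ _ _
  have h4 : 0 ≤ (Matrix.trace ((ψ.density - φ.density).conjTranspose *
      (ψ.density - φ.density))).re :=
    (Complex.le_def.1 (Matrix.posSemidef_conjTranspose_mul_self _).trace_nonneg).1
  have h5 := h1.trans (mul_le_mul_of_nonneg_right h3 h4)
  rw [h2] at h5
  simp only [Complex.sub_re, Complex.mul_re, Complex.re_ofNat, Complex.im_ofNat] at h5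
  rw [traceDistance]
  linarith [div_pow (traceNorm (ψ.density - φ.density)) 2 2]

theorem gaussianDistance_le {ψ φ : PureState n} (h : φ ∈ pureGaussianStates n) :
    gaussianDistance ψ ≤ traceDistance ψ.density φ.density := by
  refine csInf_le ⟨0, ?_⟩ ⟨φ, h, rfl⟩
  rintro _ ⟨χ, -, rfl⟩
  exact div_nonneg (traceNorm_nonneg _) zero_le_two

/-- A sufficiently close Gaussian state makes the Bell test sound. -/
theorem bell_test_of_fidelity
    (key : ∀ (n : ℕ) (ψ : PureState n), ∃ φ ∈ pureGaussianStates n,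
      1 - (expect ψ φ.density).re ≤ (n - (∑ a, ∑ b, cov ψ a b ^ 2) / 2) / 2) :
    ∃ C : ℝ, 0 < C ∧
      ∀ (n : ℕ) (ε δ : ℝ), 0 < ε → 0 < δ → δ < 1 →
        ∀ N : ℕ, C * ((n : ℝ) ^ 2 / ε ^ 2 * Real.log (1 / δ)) ≤ (N : ℝ) →
          ∀ ψ : PureState n,
            (ψ ∈ pureGaussianStates n → (bellShots ψ N).real (acceptEvent n N) = 1) ∧
            (ε ≤ gaussianDistance ψ → 1 - δ ≤ (bellShots ψ N).real (rejectEvent n N)) := by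
  refine ⟨1, one_pos, fun n ε δ hε hδ hδ1 N hN ψ => ⟨fun h => ?_, fun h => ?_⟩⟩
  · rw [bellShots_real_acceptEvent, zeroProb_eq_one h, one_pow]
  · obtain ⟨φ, hφ, hψ⟩ := key n ψ
    have h1 : ε ^ 2 ≤ n ^ 2 * (1 - zeroProb ψ) := by
      have h2 := pow_le_pow_left₀ hε.le (h.trans (gaussianDistance_le hφ)) 2
      have h3 := traceDistance_sq_le ψ φ
      have h4 := sum_bellProb_mul_bellValue_le ψ
      rw [sum_bellProb_mul_bellValue] at h4
      linarith
    -- For `n = 0` the bound `h1` would say `ε² ≤ 0`.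
    have hn : 0 < (n : ℝ) ^ 2 := by
      rcases (sq_nonneg (n : ℝ)).lt_or_eq with h0 | h0
      · exact h0
      · rw [← h0, zero_mul] at h1
        linarith [pow_pos hε 2]
    have hn' : (n : ℝ) ≠ 0 := fun h => by simp [h] at hn
    have hlog : 0 ≤ Real.log (1 / δ) := Real.log_nonneg (by rw [le_div_iff₀ hδ]; linarith)
    have h5 : ε ^ 2 / n ^ 2 ≤ 1 - zeroProb ψ := by rw [div_le_iff₀ hn]; linarith
    have h6 : Real.log (1 / δ) ≤ N * (1 - zeroProb ψ) := by
      calc Real.log (1 / δ) = (1 * ((n : ℝ) ^ 2 / ε ^ 2 * Real.log (1 / δ))) * (ε ^ 2 / n ^ 2) := by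
            field_simp
        _ ≤ N * (1 - zeroProb ψ) := mul_le_mul hN h5 (by positivity) (Nat.cast_nonneg _)
    rw [bellShots_real_rejectEvent]
    -- Uses `p ≤ exp (-(1 - p))` for the acceptance probability `p` of one shot.
    have h7 : zeroProb ψ ^ N ≤ δ := by
      calc zeroProb ψ ^ N ≤ Real.exp (-(1 - zeroProb ψ)) ^ N :=
            pow_le_pow_left₀ (zeroProb_nonneg ψ)
              (by linarith [Real.add_one_le_exp (-(1 - zeroProb ψ))]) N
        _ = Real.exp (-(N * (1 - zeroProb ψ))) := by rw [← Real.exp_nat_mul]; ring_nf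
        _ ≤ Real.exp (-Real.log (1 / δ)) := Real.exp_le_exp.2 (neg_le_neg h6)
        _ = δ := by rw [one_div, Real.log_inv, neg_neg, Real.exp_log hδ]
    linarith

end

/-! ### Construction of a nearby Gaussian state -/

section

open Filter Topology

variable {n : ℕ}

/-- The Majorana operator `∑ₐ xₐ γₐ` of a real vector `x`. -/
noncomputable def majoranaVec (x : EuclideanSpace ℝ (Fin n × Fin 2)) : Op n :=
  ∑ a, (x a : ℂ) • majorana a

theorem majoranaVec_mul (x y : EuclideanSpace ℝ (Fin n × Fin 2)) :
    majoranaVec x * majoranaVec y =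
      ∑ a, ∑ b, ((x a : ℂ) * (y b : ℂ)) • (majorana a * majorana b : Op n) := by
  rw [majoranaVec, majoranaVec, Finset.sum_mul_sum]
  refine Finset.sum_congr rfl fun a _ => Finset.sum_congr rfl fun b _ => ?_
  rw [Matrix.smul_mul, Matrix.mul_smul, smul_smul]

/-- The Clifford relations depend only on the inner product, so any orthonormal family of vectors
yields a new set of Majorana operators. -/
theorem majoranaVec_anticommutator (x y : EuclideanSpace ℝ (Fin n × Fin 2)) :
    majoranaVec x * majoranaVec y + majoranaVec y * majoranaVec x =
      ((2 * inner ℝ x y : ℝ) : ℂ) • (1 : Op n) := by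
  rw [majoranaVec_mul, majoranaVec_mul, Finset.sum_comm (f := fun a b =>
    ((y a : ℂ) * (x b : ℂ)) • (majorana a * majorana b : Op n)), ← Finset.sum_add_distrib]
  simp only [← Finset.sum_add_distrib, mul_comm (y _ : ℂ), ← smul_add, majorana_anticommutator,
    smul_ite, smul_zero, Finset.sum_ite_eq, Finset.mem_univ, if_true]
  rw [← one_add_one_eq_two (R := Op n)]
  simp only [← two_smul ℂ (1 : Op n), smul_smul]
  rw [← Finset.sum_smul, PiLp.inner_apply]
  congr 1
  push_cast
  rw [Finset.mul_sum]
  refine Finset.sum_congr rfl fun a _ => ?_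
  simp
  ring

theorem majoranaVec_conjTranspose (x : EuclideanSpace ℝ (Fin n × Fin 2)) :
    (majoranaVec x).conjTranspose = majoranaVec x := by
  rw [majoranaVec, Matrix.conjTranspose_sum]
  refine Finset.sum_congr rfl fun a _ => ?_
  rw [Matrix.conjTranspose_smul, majorana_conjTranspose, Complex.star_def, Complex.conj_ofReal]

theorem majoranaVec_mul_self {x : EuclideanSpace ℝ (Fin n × Fin 2)} (hx : ‖x‖ = 1) :
    majoranaVec x * majoranaVec x = 1 := by
  have h := majoranaVec_anticommutator x x
  rw [real_inner_self_eq_norm_sq, hx, ← two_smul ℂ, one_pow, mul_one] at h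
  exact smul_right_injective _ (two_ne_zero (α := ℂ)) (by simpa using h)

theorem majoranaVec_anticommute {x y : EuclideanSpace ℝ (Fin n × Fin 2)} (h : inner ℝ x y = 0) :
    majoranaVec x * majoranaVec y = -(majoranaVec y * majoranaVec x) := by
  rw [eq_neg_iff_add_eq_zero, majoranaVec_anticommutator, h]
  simp

theorem commute_mul_of_anticommute {R : Type*} [Ring R] {a b c : R} (h1 : a * b = -(b * a))
    (h2 : a * c = -(c * a)) : Commute a (b * c) := by
  rw [commute_iff_eq, ← mul_assoc, h1, neg_mul, mul_assoc, h2, mul_neg, neg_neg, mul_assoc]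

/-- The covariance form of a pure state, as a linear map. -/
noncomputable def covMap (ψ : PureState n) :
    EuclideanSpace ℝ (Fin n × Fin 2) →ₗ[ℝ] EuclideanSpace ℝ (Fin n × Fin 2) :=
  Matrix.toEuclideanLin (Matrix.of (cov ψ))

theorem covMap_apply (ψ : PureState n) (x : EuclideanSpace ℝ (Fin n × Fin 2))
    (a : Fin n × Fin 2) : covMap ψ x a = ∑ b, cov ψ a b * x b := by
  simp [covMap, Matrix.toEuclideanLin, Matrix.mulVec, dotProduct]

theorem covMap_skew (ψ : PureState n) (x y : EuclideanSpace ℝ (Fin n × Fin 2)) :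
    inner ℝ (covMap ψ x) y = -inner ℝ x (covMap ψ y) := by
  simp only [PiLp.inner_apply, covMap_apply, RCLike.inner_apply, conj_trivial, Finset.mul_sum,
    Finset.sum_mul, ← Finset.sum_neg_distrib]
  rw [Finset.sum_comm]
  refine Finset.sum_congr rfl fun a _ => Finset.sum_congr rfl fun b _ => ?_
  rw [cov_swap]
  ring

theorem expect_majoranaVec_mul (ψ : PureState n) (x y : EuclideanSpace ℝ (Fin n × Fin 2)) :
    expect ψ (majoranaVec x * majoranaVec y) =
      (inner ℝ x y : ℝ) + Complex.I * (inner ℝ x (covMap ψ y) : ℝ) := by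
  rw [majoranaVec_mul, expect_sum]
  simp only [expect_sum, expect_smul, expect_majorana_mul_majorana, mul_add, mul_ite, mul_one,
    mul_zero, Finset.sum_add_distrib, Finset.sum_ite_eq, Finset.mem_univ, if_true]
  simp only [PiLp.inner_apply, covMap_apply, RCLike.inner_apply, conj_trivial]
  push_cast
  simp only [Finset.mul_sum, Finset.sum_mul]
  congr 1
  · exact Finset.sum_congr rfl fun a _ => mul_comm _ _
  · exact Finset.sum_congr rfl fun a _ => Finset.sum_congr rfl fun b _ => by ring

/-- Basis independence of the Hilbert–Schmidt norm: Parseval applied to each row of the covariance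
matrix. -/
theorem sum_cov_sq (ψ : PureState n) {b : Fin n × Fin 2 → EuclideanSpace ℝ (Fin n × Fin 2)}
    (hb : Orthonormal ℝ b) :
    ∑ a, ∑ c, cov ψ a c ^ 2 = ∑ i, ‖covMap ψ (b i)‖ ^ 2 := by
  have hspan : ⊤ ≤ Submodule.span ℝ (Set.range b) :=
    (hb.linearIndependent.span_eq_top_of_card_eq_finrank' (by simp)).ge
  let B := OrthonormalBasis.mk hb hspan
  have hB : ∀ i, B i = b i := fun i => by simp [B]
  simp only [EuclideanSpace.norm_sq_eq, Real.norm_eq_abs, sq_abs]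
  rw [Finset.sum_comm (γ := Fin n × Fin 2) (f := fun i a => (covMap ψ (b i) a) ^ 2)]
  refine Finset.sum_congr rfl fun a _ => ?_
  have h := B.sum_sq_norm_inner_left (WithLp.toLp 2 (cov ψ a))
  rw [EuclideanSpace.norm_sq_eq] at h
  simp only [Real.norm_eq_abs, sq_abs] at h
  rw [← h]
  refine Finset.sum_congr rfl fun i _ => ?_
  rw [hB, covMap_apply, PiLp.inner_apply]
  simp [mul_comm]

theorem exp_smul_of_idempotent (R : Op n) (hR : R * R = R) (s : ℂ) :
    NormedSpace.exp (s • R) = (1 - R) + Complex.exp s • R := by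
  rw [NormedSpace.exp_eq_tsum ℂ]
  have h1 : HasSum (fun k : ℕ => (s ^ k / k.factorial) • R) (Complex.exp s • R) := by
    rw [Complex.exp_eq_exp_ℂ]
    exact (NormedSpace.expSeries_div_hasSum_exp s).smul_const R
  have h2 : HasSum (fun k : ℕ => if k = 0 then 1 - R else 0) (1 - R) := hasSum_ite_eq 0 _
  rw [← (h2.add h1).tsum_eq]
  refine tsum_congr fun k => ?_
  rw [smul_pow, smul_smul]
  rcases Nat.eq_zero_or_pos k with rfl | hk
  · simp
  · rw [if_neg hk.ne', zero_add, div_eq_inv_mul, (show IsIdempotentElem R from hR).pow_eq hk.ne']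

theorem expect_re_nonneg_of_projection (ψ : PureState n) {P : Op n} (h1 : P.conjTranspose = P)
    (h2 : P * P = P) : 0 ≤ (expect ψ P).re := by
  have h := expect_conjTranspose_mul_self ψ P
  rw [h1, h2] at h
  rw [h, Complex.ofReal_re]
  positivity

theorem projection_half_add {c : Op n} (h : c * c = 1) :
    ((1 / 2 : ℂ) • (1 + c)) * ((1 / 2 : ℂ) • (1 + c)) = (1 / 2 : ℂ) • (1 + c) := by
  rw [Matrix.smul_mul, Matrix.mul_smul, smul_smul, add_mul, mul_add, mul_add, h, one_mul, one_mul,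
    mul_one, ← add_comm c 1, ← two_smul ℂ (c + 1), smul_smul]
  norm_num

theorem conjTranspose_half_add {c : Op n} (h : c.conjTranspose = c) :
    ((1 / 2 : ℂ) • (1 + c)).conjTranspose = (1 / 2 : ℂ) • (1 + c) := by
  rw [Matrix.conjTranspose_smul, Matrix.conjTranspose_add, Matrix.conjTranspose_one, h]
  simp

theorem expect_half_add (ψ : PureState n) (c : Op n) :
    (expect ψ ((1 / 2 : ℂ) • (1 + c))).re = (1 + (expect ψ c).re) / 2 := by
  rw [expect_smul, expect_add, expect_one]
  simp
  ring

/-- The joint eigenprojection of a commuting family of Hermitian involutions, as the zero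
temperature limit of Gibbs operators, with a union bound for its expectation value. -/
theorem exists_joint_projection (ψ : PureState n) {ι : Type*} (c w : ι → Op n)
    (hc : ∀ j, (c j).conjTranspose = c j) (hc2 : ∀ j, c j * c j = 1)
    (hcc : ∀ i j, Commute (c i) (c j)) (hw2 : ∀ j, w j * w j = 1)
    (hwc : ∀ j, w j * c j = -(c j * w j)) (hwc' : ∀ i j, i ≠ j → Commute (w i) (c j))
    (S : Finset ι) :
    ∃ P : Op n, P.conjTranspose = P ∧ P * P = P ∧ (∀ A, (∀ j ∈ S, Commute A (c j)) → Commute A P) ∧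
      Matrix.trace P * 2 ^ S.card = 2 ^ n ∧
      Tendsto (fun t : ℝ => NormedSpace.exp
        (((-(2 * t) : ℝ) : ℂ) • ∑ j ∈ S, (1 - (1 / 2 : ℂ) • (1 + c j)))) atTop (𝓝 P) ∧
      1 - (expect ψ P).re ≤ ∑ j ∈ S, (1 - (expect ψ (c j)).re) / 2 := by
  classical
  induction S using Finset.induction_on with
  | empty =>
    refine ⟨1, Matrix.conjTranspose_one, one_mul 1, fun A _ => Commute.one_right A, ?_, ?_, ?_⟩
    · simp [Matrix.trace_one]
    · simp
    · simp [expect_one]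
  | insert k S hk ih =>
    obtain ⟨P, hP, hP2, hcomm, htr, hlim, hexp⟩ := ih
    set Q : Op n := (1 / 2 : ℂ) • (1 + c k) with hQdef
    have hQ : Q.conjTranspose = Q := conjTranspose_half_add (hc k)
    have hQ2 : Q * Q = Q := projection_half_add (hc2 k)
    have hAQ : ∀ A, Commute A (c k) → Commute A Q := fun A hA =>
      ((Commute.one_right A).add_right hA).smul_right _
    have hcP : ∀ i, Commute (c i) P := fun i => hcomm _ fun j _ => hcc i j
    have hPQ : Commute P Q := hAQ P (hcP k).symm
    refine ⟨P * Q, ?_, ?_, ?_, ?_, ?_, ?_⟩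
    · rw [Matrix.conjTranspose_mul, hP, hQ, hPQ.eq]
    · rw [mul_assoc, ← mul_assoc Q, ← hPQ.eq, mul_assoc P Q, hQ2, ← mul_assoc, hP2]
    · intro A hA
      exact (hcomm A fun j hj => hA j (Finset.mem_insert_of_mem hj)).mul_right
        (hAQ A (hA k (Finset.mem_insert_self k S)))
    -- Conjugation by `w k` fixes `P` and flips `c k`, so `tr (P c_k) = 0` and each new factor `Q`
    -- halves the trace.
    · have hwP : Commute (w k) P := hcomm _ fun j hj => hwc' k j fun h => hk (h ▸ hj)
      have h0 : Matrix.trace (P * c k) = -Matrix.trace (P * c k) := by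
        calc Matrix.trace (P * c k) = Matrix.trace ((P * c k * w k) * w k) := by
              rw [mul_assoc _ (w k), hw2, mul_one]
          _ = Matrix.trace (w k * P * (c k * w k)) := by
              rw [Matrix.trace_mul_comm, mul_assoc, mul_assoc]
          _ = -Matrix.trace (P * c k) := by
              rw [hwP.eq, mul_assoc, ← mul_assoc (w k), hwc, neg_mul, mul_assoc, hw2, mul_one,
                mul_neg, Matrix.trace_neg]
      have h1 : Matrix.trace (P * c k) = 0 := by linear_combination h0 / 2
      rw [hQdef, Matrix.mul_smul, Matrix.trace_smul, mul_add, mul_one, Matrix.trace_add, h1,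
        Finset.card_insert_of_notMem hk, pow_succ, ← htr, smul_eq_mul]
      ring
    -- The new exponential factor is `Q + exp (-2t) (1 - Q)`, which tends to `Q`.
    · have hR : (1 - Q) * (1 - Q) = 1 - Q := IsIdempotentElem.one_sub hQ2
      have h1 : ∀ t : ℝ, NormedSpace.exp
          (((-(2 * t) : ℝ) : ℂ) • ∑ j ∈ insert k S, (1 - (1 / 2 : ℂ) • (1 + c j))) =
          NormedSpace.exp (((-(2 * t) : ℝ) : ℂ) • ∑ j ∈ S, (1 - (1 / 2 : ℂ) • (1 + c j))) *
            (Q + Complex.exp ((-(2 * t) : ℝ) : ℂ) • (1 - Q)) := by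
        intro t
        have h2 := exp_smul_of_idempotent (1 - Q) hR ((-(2 * t) : ℝ) : ℂ)
        rw [sub_sub_cancel] at h2
        rw [← h2, Finset.sum_insert hk, add_comm, smul_add, Matrix.exp_add_of_commute]
        refine Commute.smul_left (Commute.smul_right (Commute.sum_left _ _ _ fun j _ => ?_) _) _
        refine (Commute.one_right _).sub_right (hAQ _ ?_)
        exact (Commute.one_left _).sub_left (((Commute.one_left _).add_left (hcc j k)).smul_left _)
      simp only [h1]
      refine hlim.mul ?_
      have h3 : Tendsto (fun t : ℝ => Complex.exp ((-(2 * t) : ℝ) : ℂ)) atTop (𝓝 0) := by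
        have : Tendsto (fun t : ℝ => Real.exp (-(2 * t))) atTop (𝓝 0) :=
          Real.tendsto_exp_neg_atTop_nhds_zero.comp
            (tendsto_id.const_mul_atTop (zero_lt_two' ℝ))
        have h4 := (Complex.continuous_ofReal.tendsto 0).comp this
        simpa [Function.comp_def, Complex.ofReal_exp] using h4
      have h5 := (tendsto_const_nhds (x := Q)).add (h3.smul_const (1 - Q))
      rwa [zero_smul, add_zero] at h5
    -- The union bound `1 - PQ ≤ (1 - P) + (1 - Q)` is positivity of the projection `(1 - P)(1 -
    -- Q)`.
    · have hc1 : Commute (1 - P) (1 - Q) :=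
        (Commute.one_left _).sub_left ((Commute.one_right P).sub_right hPQ)
      have h1 : 0 ≤ (expect ψ ((1 - P) * (1 - Q))).re := by
        refine expect_re_nonneg_of_projection ψ ?_ ?_
        · rw [Matrix.conjTranspose_mul, Matrix.conjTranspose_sub, Matrix.conjTranspose_sub, hP, hQ,
            Matrix.conjTranspose_one, hc1.eq]
        · have hP' : (1 - P) * (1 - P) = 1 - P := IsIdempotentElem.one_sub hP2
          have hQ' : (1 - Q) * (1 - Q) = 1 - Q := IsIdempotentElem.one_sub hQ2
          rw [mul_assoc, ← mul_assoc (1 - Q), ← hc1.eq, mul_assoc (1 - P) (1 - Q), hQ',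
            ← mul_assoc, hP']
      rw [show (1 - P) * (1 - Q) = 1 - P - Q + P * Q by noncomm_ring, expect_add, expect_sub,
        expect_sub, expect_one, Complex.add_re, Complex.sub_re, Complex.sub_re, Complex.one_re,
        hQdef, expect_half_add, ← hQdef] at h1
      rw [Finset.sum_insert hk]
      linarith

/-- A projection of trace one is a pure state. -/
theorem exists_density_eq_of_projection {P : Op n} (h1 : P.conjTranspose = P) (h2 : P * P = P)
    (h3 : Matrix.trace P = 1) : ∃ φ : PureState n, φ.density = P := by
  obtain ⟨v, hv⟩ : ∃ v, P.mulVec v ≠ 0 := by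
    by_contra! h
    have : P = 0 := Matrix.ext_of_mulVec_single fun i => by rw [h, Matrix.zero_mulVec]
    rw [this, Matrix.trace_zero] at h3
    exact zero_ne_one h3
  set u : EuclideanSpace ℂ (Bits n) := WithLp.toLp 2 (P.mulVec v) with hu
  have hu0 : ‖u‖ ≠ 0 := by
    rw [norm_ne_zero_iff]
    intro h
    exact hv (congrArg WithLp.ofLp h)
  let φ : PureState n := ⟨((‖u‖⁻¹ : ℝ) : ℂ) • u, by
    rw [norm_smul, Complex.norm_real, norm_inv, norm_norm, inv_mul_cancel₀ hu0]⟩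
  have hφ : P.mulVec φ.1.ofLp = φ.1.ofLp := by
    change P.mulVec (((‖u‖⁻¹ : ℝ) : ℂ) • P.mulVec v) = ((‖u‖⁻¹ : ℝ) : ℂ) • P.mulVec v
    rw [Matrix.mulVec_smul, Matrix.mulVec_mulVec, h2]
  have h4 : P * φ.density = φ.density := by
    rw [density_eq_vecMulVec, Matrix.mul_vecMulVec, hφ]
  have h5 : φ.density * P = φ.density := by
    have := congrArg Matrix.conjTranspose h4
    rwa [Matrix.conjTranspose_mul, h1, density_conjTranspose] at this
  have h6 : φ.density * φ.density = φ.density := by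
    have h : star φ.1.ofLp ⬝ᵥ φ.1.ofLp = 1 := by
      rw [← expect_one φ, expect, Matrix.one_mulVec]
    rw [density_eq_vecMulVec, Matrix.mul_vecMulVec, Matrix.vecMulVec_mulVec, h]
    simp
  -- With `φ` in the range of `P`, the squared Hilbert–Schmidt norm of the difference is `tr P - tr
  -- φ.density = 0`.
  refine ⟨φ, (sub_eq_zero.1 ?_).symm⟩
  open scoped ComplexOrder in
  rw [← Matrix.trace_conjTranspose_mul_self_eq_zero_iff, Matrix.conjTranspose_sub, h1,
    density_conjTranspose, sub_mul, mul_sub, mul_sub, h2, h4, h5, h6, sub_self, sub_zero,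
    Matrix.trace_sub, h3, trace_density, sub_self]

/-- The pure state is close to the Gaussian state given by the normal form of its covariance
matrix. -/
theorem exists_gaussian_fidelity_le (ψ : PureState n) : ∃ φ ∈ pureGaussianStates n,
    1 - (expect ψ φ.density).re ≤ (n - (∑ a, ∑ b, cov ψ a b ^ 2) / 2) / 2 := by
  obtain ⟨b, l, hb, hl0, hb0, hb1⟩ := exists_orthonormal_skew_normalForm n (by simp)
    (covMap ψ) (covMap_skew ψ)
  have hbi : ∀ {i j}, i ≠ j → inner ℝ (b i) (b j) = 0 := fun h => hb.2 h
  -- The order of the factors and the phase `-i` make `c j` a Hermitian involution with expectation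
  -- `+l j`.
  let c : Fin n → Op n := fun j => (-Complex.I) • (majoranaVec (b (j, 1)) * majoranaVec (b (j, 0)))
  let w : Fin n → Op n := fun j => majoranaVec (b (j, 0))
  have h10 : ∀ j : Fin n, majoranaVec (b (j, 1)) * majoranaVec (b (j, 0)) =
      -(majoranaVec (b (j, 0)) * majoranaVec (b (j, 1))) := fun j =>
    majoranaVec_anticommute (hbi (by simp))
  have hc : ∀ j, (c j).conjTranspose = c j := by
    intro j
    simp only [c, Matrix.conjTranspose_smul, Matrix.conjTranspose_mul, majoranaVec_conjTranspose]
    rw [h10]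
    simp
  have hw2 : ∀ j, w j * w j = 1 := fun j => majoranaVec_mul_self (hb.1 _)
  have hc2 : ∀ j, c j * c j = 1 := by
    intro j
    have h : majoranaVec (b (j, 1)) * majoranaVec (b (j, 0)) *
        (majoranaVec (b (j, 1)) * majoranaVec (b (j, 0))) = -1 := by
      nth_rewrite 2 [h10]
      rw [mul_neg, mul_assoc, ← mul_assoc (majoranaVec (b (j, 0))), majoranaVec_mul_self (hb.1 _),
        one_mul, majoranaVec_mul_self (hb.1 _)]
    simp only [c, Matrix.smul_mul, Matrix.mul_smul, smul_smul, h]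
    simp
  have hwc : ∀ j, w j * c j = -(c j * w j) := by
    intro j
    simp only [c, w, Matrix.smul_mul, Matrix.mul_smul]
    rw [← mul_assoc, ← neg_eq_iff_eq_neg.2 (h10 j), neg_mul, smul_neg]
  have hvc : ∀ (i j : Fin n) (s : Fin 2), i ≠ j → Commute (majoranaVec (b (i, s))) (c j) := by
    intro i j s hij
    have h : ∀ t, majoranaVec (b (i, s)) * majoranaVec (b (j, t)) =
        -(majoranaVec (b (j, t)) * majoranaVec (b (i, s))) := fun t =>
      majoranaVec_anticommute (hbi (by simp [hij]))
    exact (commute_mul_of_anticommute (h 1) (h 0)).smul_right _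
  have hcc : ∀ i j, Commute (c i) (c j) := by
    intro i j
    by_cases hij : i = j
    · rw [hij]
    · exact ((hvc i j 1 hij).mul_left (hvc i j 0 hij)).smul_left _
  have hexp_c : ∀ j, expect ψ (c j) = l j := by
    intro j
    simp only [c]
    rw [expect_smul, expect_majoranaVec_mul, hbi (by simp), hb0, inner_smul_right,
      real_inner_self_eq_norm_sq, hb.1]
    push_cast
    linear_combination -(l j : ℂ) * Complex.I_mul_I
  -- The projection `(1 - c_j)/2` has nonnegative expectation `(1 - l_j)/2`.
  have hl1 : ∀ j, l j ≤ 1 := by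
    intro j
    have h1 := expect_re_nonneg_of_projection ψ
      (conjTranspose_half_add (c := -c j) (by rw [Matrix.conjTranspose_neg, hc]))
      (projection_half_add (by rw [neg_mul_neg, hc2]))
    rw [expect_half_add, expect_neg, hexp_c] at h1
    simp at h1
    linarith
  obtain ⟨P, hP, hP2, -, htr, hlim, hPψ⟩ := exists_joint_projection ψ c w hc hc2 hcc hw2 hwc
    (fun i j h => hvc i j 0 h) Finset.univ
  have htr1 : Matrix.trace P = 1 := by
    rw [Finset.card_univ, Fintype.card_fin] at htr
    exact mul_right_cancel₀ (pow_ne_zero n (two_ne_zero (α := ℂ))) (by rw [htr, one_mul])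
  obtain ⟨φ, hφ⟩ := exists_density_eq_of_projection hP hP2 htr1
  refine ⟨φ, ?_, ?_⟩
  -- `K t` is chosen so that the exponent equals `t ∑_j c_j`, with `t` as inverse temperature.
  -- Writing it as `n t - 2t ∑_j (1 - c_j)/2` isolates a scalar that cancels in the normalisation
  -- and leaves a convergent exponential.
  · let K : ℝ → Matrix (Fin n × Fin 2) (Fin n × Fin 2) ℝ := fun t => Matrix.of fun p q =>
      2 * t * ∑ j, (b (j, 1) p * b (j, 0) q - b (j, 0) p * b (j, 1) q)
    have hK : ∀ t, quadraticExponent (K t) =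
        ((n * t : ℝ) : ℂ) • (1 : Op n) + ((-(2 * t) : ℝ) : ℂ) • ∑ j, (1 - (1 / 2 : ℂ) • (1 + c j)) := by
      intro t
      have h1 : ∑ p, ∑ q, (K t p q : ℂ) • (majorana p * majorana q : Op n) =
          (2 * t : ℂ) • ∑ j, (majoranaVec (b (j, 1)) * majoranaVec (b (j, 0)) -
            majoranaVec (b (j, 0)) * majoranaVec (b (j, 1))) := by
        simp only [majoranaVec_mul, ← Finset.sum_sub_distrib, ← sub_smul]
        symm
        rw [Finset.sum_comm, Finset.smul_sum]
        refine Finset.sum_congr rfl fun p _ => ?_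
        rw [Finset.sum_comm, Finset.smul_sum]
        refine Finset.sum_congr rfl fun q _ => ?_
        rw [← Finset.sum_smul, smul_smul]
        simp [K]
      have h2 : ∀ j, majoranaVec (b (j, 1)) * majoranaVec (b (j, 0)) -
          majoranaVec (b (j, 0)) * majoranaVec (b (j, 1)) = (2 * Complex.I) • c j := by
        intro j
        rw [← neg_eq_iff_eq_neg.2 (h10 j), sub_neg_eq_add, ← two_smul ℂ]
        simp only [c, smul_smul]
        congr 1
        linear_combination 2 * Complex.I_mul_I
      have h3 : ((n * t : ℝ) : ℂ) • (1 : Op n) = ∑ _j : Fin n, (t : ℂ) • (1 : Op n) := by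
        rw [Finset.sum_const, Finset.card_univ, Fintype.card_fin, ← Nat.cast_smul_eq_nsmul ℂ,
          smul_smul]
        push_cast
        rfl
      rw [quadraticExponent, h1, h3, Finset.smul_sum, Finset.smul_sum, Finset.smul_sum,
        ← Finset.sum_add_distrib]
      refine Finset.sum_congr rfl fun j _ => ?_
      rw [h2, smul_smul, smul_smul, show -(Complex.I / 4) * (2 * t) * (2 * Complex.I) = t by
        linear_combination -(t : ℂ) * Complex.I_mul_I]
      push_cast
      module
    have hgibbs : ∀ t, gibbsState (K t) = (Matrix.trace (NormedSpace.exp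
        (((-(2 * t) : ℝ) : ℂ) • ∑ j, (1 - (1 / 2 : ℂ) • (1 + c j)))))⁻¹ • NormedSpace.exp
        (((-(2 * t) : ℝ) : ℂ) • ∑ j, (1 - (1 / 2 : ℂ) • (1 + c j))) := by
      intro t
      rw [gibbsState, hK, Matrix.exp_add_of_commute _ _ ((Commute.one_left _).smul_left _),
        exp_smul_of_idempotent 1 (one_mul 1), sub_self, zero_add, Matrix.smul_mul, one_mul,
        Matrix.trace_smul, smul_smul, smul_eq_mul, mul_inv_rev, mul_assoc,
        inv_mul_cancel₀ (Complex.exp_ne_zero _), mul_one]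
    have hlim' : Tendsto (fun t => gibbsState (K t)) atTop (𝓝 φ.density) := by
      simp only [hgibbs]
      have htrlim : Tendsto (fun t : ℝ => Matrix.trace (NormedSpace.exp
          (((-(2 * t) : ℝ) : ℂ) • ∑ j, (1 - (1 / 2 : ℂ) • (1 + c j))))) atTop (𝓝 1) := by
        have h := ((continuous_id.matrix_trace).tendsto P).comp hlim
        rwa [id, htr1] at h
      have h := (htrlim.inv₀ one_ne_zero).smul hlim
      rwa [inv_one, one_smul, ← hφ] at h
    refine mem_closure_of_tendsto hlim' (Eventually.of_forall fun t => ⟨K t, ?_, rfl⟩)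
    ext p q
    simp only [K, Matrix.transpose_apply, Matrix.neg_apply, Matrix.of_apply, ← mul_neg,
      ← Finset.sum_neg_distrib]
    congr 1
    exact Finset.sum_congr rfl fun j _ => by ring
  · rw [hφ]
    have h1 : ∑ a, ∑ b, cov ψ a b ^ 2 = 2 * ∑ j, l j ^ 2 := by
      rw [sum_cov_sq ψ hb, Fintype.sum_prod_type, Finset.mul_sum]
      refine Finset.sum_congr rfl fun j _ => ?_
      rw [Fin.sum_univ_two, hb0, hb1, norm_neg, norm_smul, norm_smul, hb.1, hb.1]
      simp
      ring
    -- `0 ≤ l_j ≤ 1` gives `l_j² ≤ l_j`; this is where the linear infidelity bound meets the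
    -- quadratic mean of `X`.
    have h2 : ∑ j, (1 - (expect ψ (c j)).re) / 2 ≤ ∑ j, (1 - l j ^ 2) / 2 := by
      refine Finset.sum_le_sum fun j _ => ?_
      rw [hexp_c, Complex.ofReal_re]
      nlinarith [hl0 j, hl1 j]
    refine hPψ.trans (h2.trans ?_)
    rw [h1, ← Finset.sum_div, Finset.sum_sub_distrib]
    simp

end

end GaussTest

theorem mainTheorem1 :
    ∃ C : ℝ, 0 < C ∧
      ∀ (n : ℕ) (ε δ : ℝ), 0 < ε → 0 < δ → δ < 1 →
        ∀ N : ℕ, C * ((n : ℝ) ^ 2 / ε ^ 2 * Real.log (1 / δ)) ≤ (N : ℝ) →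
          ∀ ψ : PureState n,
            (ψ ∈ pureGaussianStates n → (bellShots ψ N).real (acceptEvent n N) = 1) ∧
            (ε ≤ gaussianDistance ψ → 1 - δ ≤ (bellShots ψ N).real (rejectEvent n N)) :=
  bell_test_of_fidelity fun _ ψ => exists_gaussian_fidelity_le ψ
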